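/- **Setting.** Let $\Phi$ be the standard normal distribution function, $s_\lambda(x)=\mathrm{sgn}(x)(|x|-\lambda)_+$, $h_\lambda(x)=xI\{|x|>\lambda\}$, $R(0,\lambda)=E(|N(0,1)|-\lambda)_+^2$ and $\log_+x=\max(1,\log x)$. Let $0<\alpha_2'<\alpha_1'<1$, $0<\beta_0\le 1/2$, $A>0$ and $M_0$ be constants. Then there is a constant $M^*$ depending only on $\{\alpha_1',\alpha_2',\beta_0,A,M_0\}$ such that the following holds. Let $\alpha_2'<\alpha_2\le\alpha_1<\alpha_1'$, $\kappa_0\in[1,2)$ and $\kappa_1<\infty$. *Sequences.* Let $0\le\delta_{1,n}\le\min(\delta_{2,n},A)$ for all $n\ge1$, and assume $1+\delta_{2,n}\le A$ for all $1\le n<n_*$, where $n_*=\min\{n\ge 2:1+n^{\beta_0-1/2}/2\le 1/\alpha_1'\}$ ($n_*=\infty$ if there is no such $n$); it is not required that $\delta_{2,n}\to0$. Let $g_{1,n}$ be differentiable functions on $(0,\infty)$ such that for all $x>0$ $$0\le g_{1,n}(x)\le x,\quad 0\le g_{1,n}'(x)\le M_0,\quad R(0,g_{1,n}(x))\le\min\Big\{4\Phi(-x),\frac{M_0\Phi(-x)}{(x^{c_{1,n}}+2)(1\vee\log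 x)^{c_{2,n}}}\Big\},$$ with $0<c_{1,n}\le2$, $|c_{2,n}|\le M_0$, and $c_{2,n}\le0$ when $c_{1,n}=2$. For $n\ge2$ let $$L_{2,n}=(\log n)^{-3/2}\Big(\frac{\delta_{1,n}(\log n)^{(5-c_{1,n})/2}}{(\log_+\log n)^{c_{2,n}}}+\frac{(\log n)^{(3-c_{1,n})/2}}{(\log_+\log n)^{c_{2,n}-1}}\Big)^{1+\delta_{1,n}}.$$ *Threshold functions.* For $\lambda\ge0$ let $t_\lambda$ satisfy $s_\lambda\le t_\lambda\le h_\lambda$ on $[0,\infty)$, $h_\lambda\le t_\lambda\le s_\lambda$ on $(-\infty,0)$, $0\le t_\lambda(y)-t_\lambda(x)\le\kappa_0(y-x)$ for $x<y$, and $|t_\lambda(x)-t_{\lambda'}(x)|\le\kappa_1|\lambda-\lambda'|$ for all $x$ and $\lambda,\lambda'\ge0$. *Data.* Let $n\ge2$, $\boldsymbol\theta\in\mathbb R^n$, and let $X_i\sim N(\theta_i,1)$, $i\le n$, be independent under $P_{\boldsymbol\theta}$. With $N(s)=\#\{i:|X_i|\ge s\}$ and $\xi_{j,k}=-\Phi^{-1}(\alpha_jk/(2n))$,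 put $$\hat\xi_1=\min\{\xi_{1,k}:1\le k\le n,\ N(\xi_{1,k})\ge k\},\qquad \hat\xi_2=\max\{\xi_{2,k}:1\le k\le n,\ N(\xi_{2,k+1})<k+1\},$$ with $\hat\xi_1=\xi_{1,1}$ if the first set is empty. Let $\hat\lambda$ be a random threshold level satisfying $$\sqrt{1+\delta_{1,n}}\;g_{1,n}(\hat\xi_1)\le\hat\lambda\le\sqrt{1+\delta_{2,n}}\;\hat\xi_2 .$$ **Claim.** If $\|\boldsymbol\theta\|_2^2\ge L_{2,n}/n^{\delta_{1,n}}$ (that is, $\|\boldsymbol\theta\|_2^2/n\ge L_{2,n}/n^{1+\delta_{1,n}}$), then $$E_{\boldsymbol\theta}\|t_{\hat\lambda}(\boldsymbol X)-\boldsymbol\theta\|^2\le M^*(1+\delta_{2,n})\inf_{\lambda\ge0}E_{\boldsymbol\theta}\|s_\lambda(\boldsymbol X)-\boldsymbol\theta\|^2,$$ where the left-hand side is finite. -/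

import Mathlib

open MeasureTheory ProbabilityTheory
open scoped NNReal

namespace FDRThreshold

noncomputable section

/-- The standard normal distribution function `Φ`. -/
def Phi (x : ℝ) : ℝ := cdf (gaussianReal 0 1) x

/-- The standard normal quantile function `Φ⁻¹` (meaningful for `p ∈ (0, 1)`). -/
def PhiInv (p : ℝ) : ℝ := sInf {x : ℝ | p ≤ Phi x}

/-- The soft threshold function `s_l(x) = sgn(x) (|x| - l)_+`. -/
def soft (l x : ℝ) : ℝ := Real.sign x * max (|x| - l) 0

/-- The hard threshold function `h_l(x) = x I{|x| > l}`. -/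
def hard (l x : ℝ) : ℝ := if l < |x| then x else 0

/-- The risk `R(μ, l)` of the soft threshold estimator of a single normal mean `μ`. -/
def softRisk (μ l : ℝ) : ℝ := ∫ x, (soft l (x + μ) - μ) ^ 2 ∂(gaussianReal 0 1)

/-- `t` is a family of smooth threshold functions, indexed by the level `l ≥ 0`: each `t l` lies
between the soft and the hard threshold functions, is nondecreasing and `κ₀`-Lipschitz, and
`t l x` is `κ₁`-Lipschitz in the level `l`. -/
structure IsSmoothThreshold (κ₀ κ₁ : ℝ) (t : ℝ → ℝ → ℝ) : Prop where
  between_of_nonneg : ∀ l x, 0 ≤ l → 0 ≤ x → soft l x ≤ t l x ∧ t l x ≤ hard l x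
  between_of_neg : ∀ l x, 0 ≤ l → x < 0 → hard l x ≤ t l x ∧ t l x ≤ soft l x
  smooth : ∀ l x y, 0 ≤ l → x < y → 0 ≤ t l y - t l x ∧ t l y - t l x ≤ κ₀ * (y - x)
  smooth_level : ∀ l l' x, 0 ≤ l → 0 ≤ l' → |t l x - t l' x| ≤ κ₁ * |l - l'|

/-- Number of coordinates of the data `x` with absolute value at least `s`. -/
def exceedCount {n : ℕ} (x : Fin n → ℝ) (s : ℝ) : ℕ :=
  (Finset.univ.filter fun i => s ≤ |x i|).card

/-- Candidate threshold levels `ξ_k = - Φ⁻¹(α k / (2 n))`. -/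
def xi (α : ℝ) (n k : ℕ) : ℝ := -PhiInv (α * k / (2 * n))

open Classical in
/-- The threshold level of the step-up (Benjamini-Hochberg) rule at nominal level `α`:
`min {ξ_k : 1 ≤ k ≤ n, N(ξ_k) ≥ k}`, which is understood as the largest candidate level `ξ_1`
when no hypothesis is rejected. -/
def xiHat₁ (α : ℝ) {n : ℕ} (x : Fin n → ℝ) : ℝ :=
  if h : ((Finset.Icc 1 n).filter fun k => k ≤ exceedCount x (xi α n k)).Nonempty then
    ((Finset.Icc 1 n).filter fun k => k ≤ exceedCount x (xi α n k)).inf' h (xi α n)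
  else xi α n 1

open Classical in
/-- The threshold level of the step-down rule at nominal level `α`:
`max {ξ_k : 1 ≤ k ≤ n, N(ξ_{k+1}) < k + 1}`. For `n ≥ 1` the set always contains `k = n`; the value
for `n = 0` is irrelevant. -/
def xiHat₂ (α : ℝ) {n : ℕ} (x : Fin n → ℝ) : ℝ :=
  if h : ((Finset.Icc 1 n).filter fun k => exceedCount x (xi α n (k + 1)) < k + 1).Nonempty then
    ((Finset.Icc 1 n).filter fun k => exceedCount x (xi α n (k + 1)) < k + 1).sup' h (xi α n)
  else 0

/-- The conditions on the function `g` and the exponents `c₁`, `c₂` in the lower bound for the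
data-driven threshold level. -/
structure IsLowerLevel (M₀ c₁ c₂ : ℝ) (g : ℝ → ℝ) : Prop where
  bounds : ∀ x, 0 < x → 0 ≤ g x ∧ g x ≤ x
  differentiable : ∀ x, 0 < x → DifferentiableAt ℝ g x
  deriv_bounds : ∀ x, 0 < x → 0 ≤ deriv g x ∧ deriv g x ≤ M₀
  risk_le : ∀ x, 0 < x → softRisk 0 (g x) ≤
    min (4 * Phi (-x)) (M₀ * Phi (-x) / ((x ^ c₁ + 2) * (max 1 (Real.log x)) ^ c₂))
  c₁_pos : 0 < c₁
  c₁_le : c₁ ≤ 2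
  abs_c₂_le : |c₂| ≤ M₀
  c₂_nonpos : c₁ = 2 → c₂ ≤ 0

/-- `log_+ x = max (1, log x)`. -/
def logPlus (x : ℝ) : ℝ := max 1 (Real.log x)

/-- The quantity `L_{2,n}` for `n ≥ 2`, with `δ = δ_{1,n}`, `c₁ = c_{1,n}`, `c₂ = c_{2,n}`. -/
def L₂ (δ c₁ c₂ : ℝ) (n : ℕ) : ℝ :=
  (Real.log n) ^ (-(3 / 2) : ℝ) *
    (δ * (Real.log n) ^ ((5 - c₁) / 2) / (logPlus (Real.log n)) ^ c₂
      + (Real.log n) ^ ((3 - c₁) / 2) / (logPlus (Real.log n)) ^ (c₂ - 1)) ^ (1 + δ)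

/-- `n_* = min {n ≥ 2 : 1 + n^{β₀ - 1/2} / 2 ≤ 1 / α₁'}`, equal to `∞` if there is no such `n`. -/
def nStar (α₁' β₀ : ℝ) : ℕ∞ :=
  sInf {N : ℕ∞ | ∃ n : ℕ, 2 ≤ n ∧ 1 + (n : ℝ) ^ (β₀ - 1 / 2) / 2 ≤ 1 / α₁' ∧ N = n}

/-- Squared error loss `‖v - θ‖²` in `ℝⁿ`. -/
def sqLoss {n : ℕ} (v θ : Fin n → ℝ) : ℝ := ∑ i, (v i - θ i) ^ 2

end

end FDRThreshold

/-! Coordinates are split into small and large means, and both groups are compared with `∑ softRisk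
(θ i) l`, the risk of soft thresholding, for every fixed level `l`. Two lower bounds on that risk
suffice: it is at least a constant times `min (θ i ^ 2) (l ^ 2 + 1)` (`min_sq_add_one_le_softRisk`),
and at least half the null risk (`softRisk_zero_le_two_mul`).

For a small mean, the loss is at most a multiple of `θ i ^ 2` plus the part of the noise beyond the
level, so only the lower bound on the level matters. If `ξ̂₁ = ξ_k`, at least `k - 1` coordinates
other than `i` exceed `ξ_k`, while at most `α k + B` exceedances are expected, with `B = ∑ min (θ i
^ 2) 1`. An exponential tilt of the other coordinates, independent of `X i`, gives this event a
weight of order `exp (2 B - c k)` (`exists_noise_bound`). Summed over `k`, the surviving noise is of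
order `B` (`exists_total_noise_bound`). When `B ≥ 1` this follows from the crude bound `4 Φ(-x)` on
the null risk. When `B < 1` one has `B = ‖θ‖²`, and the assumed lower bound on `‖θ‖²` dominates the
null noise at the inflated level (`exists_null_risk_le`).

For a large mean, the loss is at most twice the squared level plus twice the squared noise, so the
step-down level must be bounded. Let `m` be the least positive integer such that at least `D n exp
(-m² / 2)` means reach `m` in absolute value. These means force so many exceedances that `E ξ̂₂² ≤
14 m²` (`exists_xiHat₂_bound`). Minimality of `m` keeps the counts below it at Gaussian size, so `∑
min (θ i ^ 2) (m ^ 2)` is within a constant of every soft threshold risk (`sum_min_sq_le`). That sum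
is exactly `m²` per large mean plus the squares of the small means, which is what both groups cost.
-/

namespace FDRThreshold

/-! ### Gaussian tails and exceedance probabilities. -/

section Gaussian

open Set Filter Topology

lemma gaussianPDFReal_std (x : ℝ) :
    gaussianPDFReal 0 1 x = (√(2 * Real.pi))⁻¹ * Real.exp (-x ^ 2 / 2) := by
  simp [gaussianPDFReal]

lemma gaussianPDFReal_std_abs (x : ℝ) : gaussianPDFReal 0 1 |x| = gaussianPDFReal 0 1 x := by
  simp [gaussianPDFReal_std]

lemma gaussianPDFReal_std_add (x m : ℝ) :
    gaussianPDFReal 0 1 (x + m) = Real.exp (-m * x - m ^ 2 / 2) * gaussianPDFReal 0 1 x := by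
  rw [gaussianPDFReal_std, gaussianPDFReal_std, mul_left_comm, ← Real.exp_add]
  ring_nf

lemma continuous_gaussianPDFReal_std : Continuous (gaussianPDFReal 0 1) := by
  have : gaussianPDFReal 0 1 = fun x => (√(2 * Real.pi))⁻¹ * Real.exp (-x ^ 2 / 2) :=
    funext gaussianPDFReal_std
  rw [this]
  fun_prop

lemma inv_sqrt_two_pi_lt : (√(2 * Real.pi))⁻¹ < 1 / 2 := by
  rw [inv_lt_comm₀ (by positivity) (by norm_num)]
  refine Real.lt_sqrt_of_sq_lt ?_
  nlinarith [Real.pi_gt_three]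

lemma lt_inv_sqrt_two_pi : 1 / 3 < (√(2 * Real.pi))⁻¹ := by
  rw [lt_inv_comm₀ (by norm_num) (by positivity), Real.sqrt_lt' (by norm_num)]
  nlinarith [Real.pi_lt_four]

lemma Phi_eq_real (x : ℝ) : Phi x = (gaussianReal 0 1).real (Iic x) := cdf_eq_real _ x

lemma Phi_eq_integral (x : ℝ) : Phi x = ∫ u in Iic x, gaussianPDFReal 0 1 u := by
  rw [Phi_eq_real, Measure.real, gaussianReal_apply_eq_integral 0 one_ne_zero,
    ENNReal.toReal_ofReal (integral_nonneg fun _ => gaussianPDFReal_nonneg _ _ _)]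

lemma hasDerivAt_Phi (x : ℝ) : HasDerivAt Phi (gaussianPDFReal 0 1 x) x := by
  have hi := integrable_gaussianPDFReal 0 1
  have h : Phi = fun y => Phi 0 + ∫ u in (0 : ℝ)..y, gaussianPDFReal 0 1 u := by
    funext y
    rw [← intervalIntegral.integral_Iic_sub_Iic hi.integrableOn hi.integrableOn,
      Phi_eq_integral, Phi_eq_integral]
    ring
  rw [h]
  exact (intervalIntegral.integral_hasDerivAt_right hi.intervalIntegrable
    (continuous_gaussianPDFReal_std.stronglyMeasurableAtFilter _ _)
    continuous_gaussianPDFReal_std.continuousAt).const_add _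

lemma strictMono_Phi : StrictMono Phi :=
  strictMono_of_deriv_pos fun x => by
    rw [(hasDerivAt_Phi x).deriv]
    exact gaussianPDFReal_pos _ _ _ one_ne_zero

lemma continuous_Phi : Continuous Phi :=
  continuous_iff_continuousAt.2 fun x => (hasDerivAt_Phi x).continuousAt

lemma Phi_PhiInv {p : ℝ} (h0 : 0 < p) (h1 : p < 1) : Phi (PhiInv p) = p := by
  obtain ⟨x, hx⟩ : ∃ x, Phi x = p := by
    have := mem_range_of_exists_le_of_exists_ge continuous_Phi (c := p) ?_ ?_
    · exact this
    · exact ((tendsto_cdf_atBot (gaussianReal 0 1)).eventually_le_const h0).exists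
    · exact ((tendsto_cdf_atTop (gaussianReal 0 1)).eventually_const_le h1).exists
  have : {y : ℝ | p ≤ Phi y} = Ici x := by
    ext y
    simp [← hx, strictMono_Phi.le_iff_le]
  rw [PhiInv, this, csInf_Ici, hx]

lemma real_Ici_gaussianReal (x : ℝ) : (gaussianReal 0 1).real (Ici x) = Phi (-x) := by
  have h : (gaussianReal 0 1).map (fun x => -x) = gaussianReal 0 1 := by
    rw [gaussianReal_map_neg, neg_zero]
  have h' := map_measureReal_apply (μ := gaussianReal 0 1) measurable_neg
    (measurableSet_Iic (a := -x))
  rw [Phi_eq_real, ← Set.neg_Ici]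
  rw [← Set.neg_Ici] at h'
  simp only [neg_preimage, neg_neg] at h'
  rw [← h', show (Neg.neg : ℝ → ℝ) = fun x => -x from rfl, h]

lemma Phi_neg (x : ℝ) : Phi (-x) = 1 - Phi x := by
  have := nullSingletonClass_gaussianReal (μ := 0) (v := 1) one_ne_zero
  have h : (gaussianReal 0 1).real (Ici x) = (gaussianReal 0 1).real (Iic x)ᶜ := by
    rw [compl_Iic]
    exact measureReal_congr Ioi_ae_eq_Ici.symm
  rw [← real_Ici_gaussianReal, h, probReal_compl_eq_one_sub measurableSet_Iic, Phi_eq_real]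

lemma Phi_zero : Phi 0 = 1 / 2 := by
  have := Phi_neg 0
  rw [neg_zero] at this
  linarith

lemma Phi_pos (x : ℝ) : 0 < Phi x :=
  lt_of_le_of_lt (cdf_nonneg _ (x - 1)) (strictMono_Phi (by linarith))

/-- A shift of the Gaussian tail gains an exponential factor. -/
lemma exp_mul_Phi_neg_le (s : ℝ) {m : ℝ} (hm : 0 ≤ m) :
    Real.exp (s * m - m ^ 2 / 2) * Phi (-s) ≤ Phi (m - s) := by
  have hi := integrable_gaussianPDFReal 0 1
  rw [Phi_eq_integral, Phi_eq_integral, ← integral_indicator measurableSet_Iic,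
    ← integral_indicator measurableSet_Iic, ← integral_const_mul,
    ← integral_add_right_eq_self (fun x => (Iic (m - s)).indicator (gaussianPDFReal 0 1) x) m]
  refine integral_mono ((hi.indicator measurableSet_Iic).const_mul _)
    ((hi.indicator measurableSet_Iic).comp_add_right m) fun x => ?_
  simp only [indicator_apply, mem_Iic]
  have e : x + m ≤ m - s ↔ x ≤ -s := by constructor <;> intro h <;> linarith
  simp only [e]
  split_ifs with h
  · rw [gaussianPDFReal_std_add]
    exact mul_le_mul_of_nonneg_right (Real.exp_le_exp.2 (by nlinarith))
      (gaussianPDFReal_nonneg _ _ _)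
  · simp

/-- Shifting the tail by `m = s` lands at `Φ(0) = 1 / 2`. -/
lemma Phi_neg_le {s : ℝ} (hs : 0 ≤ s) : Phi (-s) ≤ Real.exp (-s ^ 2 / 2) / 2 := by
  have h := exp_mul_Phi_neg_le s hs
  rw [sub_self, Phi_zero] at h
  have : Real.exp (-s ^ 2 / 2) * Real.exp (s * s - s ^ 2 / 2) = 1 := by
    rw [← Real.exp_add, ← Real.exp_zero]
    ring_nf
  nlinarith [Real.exp_pos (-s ^ 2 / 2), Phi_pos (-s)]

/-- The mass of the unit interval from `-(x + 1)` to `-x` is the density at an intermediate point,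
which is smallest at the far end. -/
lemma le_Phi_neg {x : ℝ} (hx : 0 ≤ x) : Real.exp (-(x + 1) ^ 2 / 2) / 3 ≤ Phi (-x) := by
  obtain ⟨c, hc, h⟩ := exists_hasDerivAt_eq_slope Phi (gaussianPDFReal 0 1)
    (show -(x + 1) < -x by linarith) continuous_Phi.continuousOn fun y _ => hasDerivAt_Phi y
  have h1 : Phi (-x) - Phi (-(x + 1)) = gaussianPDFReal 0 1 c := by
    rw [h]; field_simp; ring
  have h2 : Real.exp (-(x + 1) ^ 2 / 2) ≤ Real.exp (-c ^ 2 / 2) := by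
    refine Real.exp_le_exp.2 ?_
    have h3 := hc.1
    have h4 := hc.2
    nlinarith
  rw [gaussianPDFReal_std] at h1
  nlinarith [lt_inv_sqrt_two_pi, Phi_pos (-(x + 1)), Real.exp_pos (-(x + 1) ^ 2 / 2)]

lemma abs_mul_exp_le (u : ℝ) : |u| * Real.exp (-u ^ 2 / 2) ≤ 1 := by
  have h1 : |u| ≤ Real.exp (u ^ 2 / 2) := by
    have := Real.add_one_le_exp (u ^ 2 / 2)
    nlinarith [sq_nonneg (|u| - 1), sq_abs u]
  calc |u| * Real.exp (-u ^ 2 / 2) ≤ Real.exp (u ^ 2 / 2) * Real.exp (-u ^ 2 / 2) := by gcongr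
    _ = 1 := by rw [← Real.exp_add, ← Real.exp_zero]; ring_nf

lemma gaussianPDFReal_std_sub_le {x y : ℝ} (h : x ≤ y) :
    gaussianPDFReal 0 1 y - gaussianPDFReal 0 1 x ≤ y - x := by
  have hd : ∀ u, HasDerivAt (gaussianPDFReal 0 1)
      ((√(2 * Real.pi))⁻¹ * (Real.exp (-u ^ 2 / 2) * -u)) u := by
    intro u
    have : gaussianPDFReal 0 1 = fun x => (√(2 * Real.pi))⁻¹ * Real.exp (-x ^ 2 / 2) :=
      funext gaussianPDFReal_std
    rw [this]
    have h1 : HasDerivAt (fun x : ℝ => -x ^ 2 / 2) (-u) u := by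
      exact ((hasDerivAt_pow 2 u).neg.div_const 2).congr_deriv (by push_cast; ring)
    exact (h1.exp).const_mul _
  have := Convex.image_sub_le_mul_sub_of_deriv_le convex_univ
    (f := gaussianPDFReal 0 1) (fun u _ => (hd u).continuousAt.continuousWithinAt)
    (fun u _ => (hd u).differentiableAt.differentiableWithinAt) (C := 1) ?_ x (mem_univ _) y
    (mem_univ _) h
  · linarith
  · intro u _
    rw [(hd u).deriv]
    have h1 := abs_mul_exp_le u
    have h2 := neg_abs_le u
    have h4 := inv_sqrt_two_pi_lt
    have h5 : 0 < (√(2 * Real.pi))⁻¹ := by positivity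
    have h6 : Real.exp (-u ^ 2 / 2) * -u ≤ 1 := by
      nlinarith [Real.exp_pos (-u ^ 2 / 2)]
    nlinarith

/-- Second order bound for the symmetrized distribution function. -/
lemma Phi_add_Phi_sub_le (a u : ℝ) : Phi (a + u) + Phi (a - u) ≤ 2 * Phi a + u ^ 2 := by
  have key : ∀ u, 0 ≤ u → Phi (a + u) + Phi (a - u) ≤ 2 * Phi a + u ^ 2 := by
    intro u hu
    -- `f 0 = 2 Φ(a)`, and `f` decreases on `[0, ∞)` because the density is 1-Lipschitz.
    let f : ℝ → ℝ := fun u => Phi (a + u) + Phi (a - u) - u ^ 2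
    have hd : ∀ v, HasDerivAt f
        (gaussianPDFReal 0 1 (a + v) - gaussianPDFReal 0 1 (a - v) - 2 * v) v := by
      intro v
      have h1 : HasDerivAt (fun v => Phi (a + v)) (gaussianPDFReal 0 1 (a + v)) v :=
        (hasDerivAt_Phi (a + v)).comp_const_add a v
      have h2 : HasDerivAt (fun v => Phi (a - v)) (-gaussianPDFReal 0 1 (a - v)) v :=
        (hasDerivAt_Phi (a - v)).comp_const_sub a v
      exact ((h1.add h2).sub (hasDerivAt_pow 2 v)).congr_deriv (by push_cast; ring)
    have hanti : AntitoneOn f (Ici 0) := by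
      refine antitoneOn_of_deriv_nonpos (convex_Ici 0)
        (fun v _ => (hd v).continuousAt.continuousWithinAt)
        (fun v _ => (hd v).differentiableAt.differentiableWithinAt) fun v hv => ?_
      rw [interior_Ici, mem_Ioi] at hv
      rw [(hd v).deriv]
      have := gaussianPDFReal_std_sub_le (x := a - v) (y := a + v) (by linarith)
      linarith
    have := hanti (mem_Ici.2 le_rfl) (mem_Ici.2 hu) hu
    simp only [f, add_zero, sub_zero] at this
    nlinarith
  rcases le_total 0 u with h | h
  · exact key u h
  · have := key (-u) (by linarith)
    rw [neg_sq, sub_neg_eq_add, ← sub_eq_add_neg] at this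
    linarith

/-- Two-sided exceedance probability of a normal variable with unit variance. -/
lemma real_abs_ge_gaussianReal (θ : ℝ) {s : ℝ} (hs : 0 < s) :
    (gaussianReal θ 1).real {x | s ≤ |x|} = Phi (-s + θ) + Phi (-s - θ) := by
  have h : (gaussianReal 0 1).map (fun x => x + θ) = gaussianReal θ 1 := by
    rw [gaussianReal_map_add_const, zero_add]
  have hm : MeasurableSet {x : ℝ | s ≤ |x|} := measurableSet_le measurable_const (by fun_prop)
  rw [← h, map_measureReal_apply (by fun_prop) hm]
  have : (fun x => x + θ) ⁻¹' {x : ℝ | s ≤ |x|} = Ici (s - θ) ∪ Iic (-s - θ) := by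
    ext x
    simp only [mem_preimage, mem_ofPred_eq, le_abs, mem_union, mem_Ici, mem_Iic]
    constructor <;> rintro (h | h) <;> first | (left; linarith) | (right; linarith)
  rw [this, measureReal_union _ measurableSet_Iic, real_Ici_gaussianReal, ← Phi_eq_real]
  · ring_nf
  · refine Set.disjoint_left.2 fun x hx hx' => ?_
    simp only [mem_Ici, mem_Iic] at hx hx'
    linarith

/-- The first-order effects of a small mean on the two tails cancel, so the excess probability is
quadratic. This makes `∑ min (θ i ^ 2) 1` the measure of signal in exceedance counts. -/
lemma real_abs_ge_gaussianReal_le (θ : ℝ) {s : ℝ} (hs : 0 < s) :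
    (gaussianReal θ 1).real {x | s ≤ |x|} ≤ 2 * Phi (-s) + min (θ ^ 2) 1 := by
  rcases le_total (θ ^ 2) 1 with h | h
  · rw [min_eq_left h, real_abs_ge_gaussianReal θ hs]
    exact Phi_add_Phi_sub_le _ _
  · rw [min_eq_right h]
    have : (gaussianReal θ 1).real {x | s ≤ |x|} ≤ 1 := measureReal_le_one
    linarith [Phi_pos (-s)]

lemma le_real_abs_ge_gaussianReal {θ m s : ℝ} (hs : 0 < s) (hm : 0 ≤ m) (h : m ≤ |θ|) :
    Real.exp (s * m - m ^ 2 / 2) * Phi (-s) ≤ (gaussianReal θ 1).real {x | s ≤ |x|} := by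
  rw [real_abs_ge_gaussianReal θ hs]
  have h1 : Phi (m - s) ≤ Phi (-s + |θ|) := strictMono_Phi.monotone (by linarith)
  refine (exp_mul_Phi_neg_le s hm).trans (h1.trans ?_)
  rcases le_total 0 θ with h0 | h0
  · rw [abs_of_nonneg h0]
    linarith [Phi_pos (-s - θ)]
  · rw [abs_of_nonpos h0, ← sub_eq_add_neg]
    linarith [Phi_pos (-s + θ)]

end Gaussian

/-! ### Upper and lower bounds for the soft threshold risk. -/

section SoftRisk

open Set

lemma soft_eq {l : ℝ} (hl : 0 ≤ l) (x : ℝ) : soft l x = max (x - l) 0 - max (-x - l) 0 := by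
  unfold soft
  rcases lt_trichotomy x 0 with h | h | h
  · rw [Real.sign_of_neg h, abs_of_neg h, max_eq_right (by linarith : x - l ≤ 0)]
    ring
  · subst h
    simp
  · rw [Real.sign_of_pos h, abs_of_pos h, max_eq_right (by linarith : -x - l ≤ 0)]
    ring

lemma soft_sq {l : ℝ} (hl : 0 ≤ l) (x : ℝ) : soft l x ^ 2 = max (|x| - l) 0 ^ 2 := by
  rw [soft_eq hl]
  rcases le_total x 0 with h | h
  · rw [abs_of_nonpos h, max_eq_right (by linarith : x - l ≤ 0)]
    ring
  · rw [abs_of_nonneg h, max_eq_right (by linarith : -x - l ≤ 0)]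
    ring

lemma soft_neg {l : ℝ} (hl : 0 ≤ l) (x : ℝ) : soft l (-x) = -soft l x := by
  rw [soft_eq hl, soft_eq hl, neg_neg]
  ring

lemma continuous_soft {l : ℝ} (hl : 0 ≤ l) : Continuous (soft l) := by
  rw [funext (soft_eq hl)]
  fun_prop

lemma soft_add_le {l : ℝ} (hl : 0 ≤ l) (x : ℝ) {μ : ℝ} (hμ : 0 ≤ μ) :
    soft l (x + μ) ≤ soft l x + μ := by
  rw [soft_eq hl, soft_eq hl]
  rcases max_cases (x + μ - l) 0 with h1 | h1 <;> rcases max_cases (-(x + μ) - l) 0 with h2 | h2 <;>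
    rcases max_cases (x - l) 0 with h3 | h3 <;> rcases max_cases (-x - l) 0 with h4 | h4 <;>
    linarith

lemma soft_mono {l : ℝ} (hl : 0 ≤ l) : Monotone (soft l) := by
  intro x y h
  rw [soft_eq hl, soft_eq hl]
  have h1 : max (x - l) 0 ≤ max (y - l) 0 := max_le_max_right _ (by linarith)
  have h2 : max (-y - l) 0 ≤ max (-x - l) 0 := max_le_max_right _ (by linarith)
  linarith

lemma soft_nonpos {l : ℝ} (hl : 0 ≤ l) {x : ℝ} (hx : x ≤ 0) : soft l x ≤ 0 := by
  rw [soft_eq hl, max_eq_right (by linarith : x - l ≤ 0)]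
  linarith [le_max_right (-x - l) 0]

lemma abs_soft_add_sub_le {l : ℝ} (hl : 0 ≤ l) (x μ : ℝ) : |soft l (x + μ) - μ| ≤ |x| + l := by
  rw [soft_eq hl, abs_le]
  have := le_abs_self x
  have := neg_abs_le x
  constructor <;> rcases max_cases (x + μ - l) 0 with h1 | h1 <;>
    rcases max_cases (-(x + μ) - l) 0 with h2 | h2 <;> linarith

lemma integrable_sq_gaussianReal (μ : ℝ) (v : ℝ≥0) :
    Integrable (fun x : ℝ => x ^ 2) (gaussianReal μ v) :=
  (memLp_id_gaussianReal (μ := μ) (v := v) 2).integrable_sq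

lemma integrable_soft_sub_sq {l : ℝ} (hl : 0 ≤ l) (μ : ℝ) :
    Integrable (fun x => (soft l (x + μ) - μ) ^ 2) (gaussianReal 0 1) := by
  have hc := continuous_soft hl
  refine (((integrable_sq_gaussianReal 0 1).const_mul 2).add (integrable_const (2 * l ^ 2))).mono'
    (by fun_prop) (ae_of_all _ fun x => ?_)
  rw [Real.norm_of_nonneg (sq_nonneg _), ← sq_abs]
  have h := abs_soft_add_sub_le hl x μ
  simp only [Pi.add_apply]
  nlinarith [abs_nonneg (soft l (x + μ) - μ), sq_abs x, sq_nonneg (|x| - l)]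

lemma softRisk_nonneg (μ l : ℝ) : 0 ≤ softRisk μ l := integral_nonneg fun _ => sq_nonneg _

lemma integral_neg_gaussianReal (f : ℝ → ℝ) :
    ∫ x, f (-x) ∂(gaussianReal 0 1) = ∫ x, f x ∂(gaussianReal 0 1) := by
  have h : (gaussianReal 0 1).map (MeasurableEquiv.neg ℝ) = gaussianReal 0 1 := by
    have := gaussianReal_map_neg (μ := 0) (v := 1)
    rwa [neg_zero] at this
  conv_rhs => rw [← h]
  rw [integral_map_equiv]
  rfl

lemma softRisk_neg {l : ℝ} (hl : 0 ≤ l) (μ : ℝ) : softRisk (-μ) l = softRisk μ l := by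
  unfold softRisk
  rw [← integral_neg_gaussianReal]
  refine integral_congr_ae (ae_of_all _ fun x => ?_)
  simp only
  rw [show -x + -μ = -(x + μ) by ring, soft_neg hl]
  ring

lemma softRisk_abs {l : ℝ} (hl : 0 ≤ l) (μ : ℝ) : softRisk |μ| l = softRisk μ l := by
  rcases abs_choice μ with h | h <;> rw [h]
  exact softRisk_neg hl μ

lemma softRisk_zero_eq {l : ℝ} (hl : 0 ≤ l) :
    softRisk 0 l = ∫ x, max (|x| - l) 0 ^ 2 ∂(gaussianReal 0 1) := by
  simp [softRisk, soft_sq hl]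

/-- A pointwise lower bound on the symmetrized loss gives a lower bound on the risk. -/
lemma integral_le_two_mul_softRisk {l μ : ℝ} (hl : 0 ≤ l) {f : ℝ → ℝ}
    (hf : Integrable f (gaussianReal 0 1)) (hs : ∀ x, f (-x) = f x)
    (h : ∀ x ≤ 0, f x ≤ (soft l (x + μ) - μ) ^ 2) :
    ∫ x, f x ∂(gaussianReal 0 1) ≤ 2 * softRisk μ l := by
  have hi := integrable_soft_sub_sq hl μ
  have hi' : Integrable (fun x => (soft l (-x + μ) - μ) ^ 2) (gaussianReal 0 1) := by
    have hm : MeasurePreserving (fun x : ℝ => -x) (gaussianReal 0 1) (gaussianReal 0 1) :=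
      ⟨measurable_neg, by rw [gaussianReal_map_neg, neg_zero]⟩
    exact hm.integrable_comp_of_integrable hi
  have e : ∫ x, ((soft l (x + μ) - μ) ^ 2 + (soft l (-x + μ) - μ) ^ 2) ∂(gaussianReal 0 1)
      = 2 * softRisk μ l := by
    rw [integral_add hi hi', integral_neg_gaussianReal (fun x => (soft l (x + μ) - μ) ^ 2)]
    unfold softRisk
    ring
  rw [← e]
  refine integral_mono hf (hi.add hi') fun x => ?_
  rcases le_total x 0 with hx | hx
  · have := h x hx
    simp only
    linarith [sq_nonneg (soft l (-x + μ) - μ)]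
  · have := h (-x) (by linarith)
    rw [hs] at this
    simp only
    linarith [sq_nonneg (soft l (x + μ) - μ)]

/-- With noise `x ≤ 0` and mean `μ ≥ 0`, the null error `soft l x` is already nonpositive, and the
mean raises the estimate by at most `μ`; the error can only move further below zero. Half of the
noise distribution is enough. -/
lemma softRisk_zero_le_two_mul {l : ℝ} (hl : 0 ≤ l) (μ : ℝ) :
    softRisk 0 l ≤ 2 * softRisk μ l := by
  rw [← softRisk_abs hl μ]
  have hi := integrable_soft_sub_sq hl 0
  refine integral_le_two_mul_softRisk hl hi (fun x => ?_) fun x hx => ?_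
  · simp [soft_sq hl]
  · rw [add_zero, sub_zero]
    have h1 := soft_add_le hl x (abs_nonneg μ)
    have h2 := soft_nonpos hl hx
    nlinarith

/-- Whenever the noise pushes against the mean, the estimate falls short by at least the shrinkage
bias `min |μ| l`. -/
lemma min_sq_le_two_mul_softRisk {l : ℝ} (hl : 0 ≤ l) (μ : ℝ) :
    min |μ| l ^ 2 ≤ 2 * softRisk μ l := by
  rw [← softRisk_abs hl μ]
  have := integral_le_two_mul_softRisk hl (μ := |μ|) (f := fun _ => min |μ| l ^ 2)
    (integrable_const _) (fun _ => rfl) fun x hx => ?_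
  · simpa using this
  · have h1 : soft l (x + |μ|) ≤ soft l |μ| := soft_mono hl (by linarith)
    have h2 : soft l |μ| - |μ| = -min |μ| l := by
      rw [soft_eq hl]
      have := abs_nonneg μ
      rcases max_cases (|μ| - l) 0 with h1 | h1 <;> rcases max_cases (-|μ| - l) 0 with h2 | h2 <;>
        rcases min_cases |μ| l with h3 | h3 <;> linarith
    have h3 : 0 ≤ min |μ| l := le_min (abs_nonneg μ) hl
    nlinarith

lemma integral_max_sq_eq {l : ℝ} (hl : 0 ≤ l) :
    ∫ x, max (|x| - l) 0 ^ 2 ∂(gaussianReal 0 1) =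
      2 * ∫ u in Ioi 0, u ^ 2 * gaussianPDFReal 0 1 (u + l) := by
  rw [integral_gaussianReal_eq_integral_smul one_ne_zero]
  have h1 : ∀ x : ℝ, gaussianPDFReal 0 1 x • max (|x| - l) 0 ^ 2 =
      (fun y => max (y - l) 0 ^ 2 * gaussianPDFReal 0 1 y) |x| := by
    intro x
    simp only [gaussianPDFReal_std_abs, smul_eq_mul]
    ring
  rw [integral_congr_ae (ae_of_all _ h1), integral_comp_abs
    (f := fun y => max (y - l) 0 ^ 2 * gaussianPDFReal 0 1 y), ← integral_indicator measurableSet_Ioi,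
    ← integral_indicator measurableSet_Ioi,
    ← integral_add_right_eq_self (fun x => (Ioi 0).indicator _ x) l]
  congr 2
  funext u
  by_cases hu : 0 < u
  · rw [indicator_of_mem (by simp only [mem_Ioi]; linarith), indicator_of_mem (by simpa using hu)]
    rw [add_sub_cancel_right, max_eq_left hu.le]
  · rw [indicator_of_notMem (s := Ioi 0) (a := u) (by simpa using hu)]
    refine indicator_apply_eq_zero.2 fun _ => ?_
    rw [add_sub_cancel_right, max_eq_right (by linarith)]
    ring

/-- Since `(u - 1)² ≥ 0`, the exponent `-(u + l)² / 2` is at most `1/2 - l² / 2 - (1 + l) u`. The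
remaining Gamma integral has rate `1 + l`, so the bound does not degenerate at `l = 0`. -/
lemma softRisk_zero_le {l : ℝ} (hl : 0 ≤ l) :
    softRisk 0 l ≤ 4 * Real.exp (-l ^ 2 / 2) / (1 + l) ^ 3 := by
  rw [softRisk_zero_eq hl, integral_max_sq_eq hl]
  have hG : ∫ u in Ioi (0 : ℝ), u ^ 2 * Real.exp (-((1 + l) * u)) = 2 / (1 + l) ^ 3 := by
    have := Real.integral_rpow_mul_exp_neg_mul_Ioi (a := 3) (r := 1 + l) (by norm_num)
      (by linarith)
    have hg : Real.Gamma 3 = 2 := by norm_num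
    rw [hg] at this
    norm_num at this
    rw [this]
    field_simp
  have hI : IntegrableOn (fun u : ℝ => u ^ 2 * Real.exp (-((1 + l) * u))) (Ioi 0) := by
    refine not_not.1 fun h => ?_
    rw [integral_undef h] at hG
    have : 0 < 2 / (1 + l) ^ 3 := by positivity
    linarith
  have h1 : ∫ u in Ioi (0 : ℝ), u ^ 2 * gaussianPDFReal 0 1 (u + l) ≤
      ∫ u in Ioi (0 : ℝ), Real.exp (-l ^ 2 / 2) * (u ^ 2 * Real.exp (-((1 + l) * u))) := by
    refine integral_mono_of_nonneg (ae_of_all _ fun u => ?_) (hI.const_mul _)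
      (ae_of_all _ fun u => ?_)
    · exact mul_nonneg (sq_nonneg _) (gaussianPDFReal_nonneg _ _ _)
    · simp only
      rw [mul_left_comm]
      refine mul_le_mul_of_nonneg_left ?_ (sq_nonneg u)
      rw [gaussianPDFReal_std, ← Real.exp_add]
      have h2 : Real.exp (-(u + l) ^ 2 / 2) ≤
          Real.exp (1 / 2) * Real.exp (-l ^ 2 / 2 + -((1 + l) * u)) := by
        rw [← Real.exp_add]
        refine Real.exp_le_exp.2 ?_
        nlinarith [sq_nonneg (u - 1)]
      have h3 : Real.exp (1 / 2) ≤ 2 := by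
        have := Real.exp_one_lt_d9
        have h4 : Real.exp (1 / 2) ^ 2 = Real.exp 1 := by
          rw [← Real.exp_nat_mul]; norm_num
        nlinarith [Real.exp_pos (1 / 2)]
      have h5 := inv_sqrt_two_pi_lt
      have h6 := Real.exp_pos (-l ^ 2 / 2 + -((1 + l) * u))
      have h7 : 0 < (√(2 * Real.pi))⁻¹ := by positivity
      calc _ ≤ (√(2 * Real.pi))⁻¹ * (2 * Real.exp (-l ^ 2 / 2 + -((1 + l) * u))) := by
            refine mul_le_mul_of_nonneg_left (h2.trans ?_) h7.le
            exact mul_le_mul_of_nonneg_right h3 h6.le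
        _ ≤ _ := by nlinarith
  rw [integral_const_mul, hG] at h1
  calc _ ≤ 2 * (Real.exp (-l ^ 2 / 2) * (2 / (1 + l) ^ 3)) := by linarith
    _ = _ := by ring

/-- The excess over `l` has scale `a = 1 / (1 + l)`; restricting the integral to `[a, 2a]` loses
only a constant. -/
lemma le_softRisk_zero {l : ℝ} (hl : 0 ≤ l) :
    Real.exp (-5) * Real.exp (-l ^ 2 / 2) / (1 + l) ^ 3 ≤ softRisk 0 l := by
  rw [softRisk_zero_eq hl, integral_max_sq_eq hl]
  -- An undefined integral has value 0, which would make the null risk vanish although `[l + 1, ∞)`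
  -- has positive mass.
  have hI : IntegrableOn (fun u : ℝ => u ^ 2 * gaussianPDFReal 0 1 (u + l)) (Ioi 0) := by
    refine not_not.1 fun h => ?_
    have hz : softRisk 0 l = 0 := by
      rw [softRisk_zero_eq hl, integral_max_sq_eq hl, integral_undef h, mul_zero]
    have h2 : (fun x => (soft l (x + 0) - 0) ^ 2) =ᵐ[gaussianReal 0 1] 0 :=
      (integral_eq_zero_iff_of_nonneg (fun _ => sq_nonneg _) (integrable_soft_sub_sq hl 0)).1 hz
    have h3 : (gaussianReal 0 1).real (Ici (l + 1)) = 0 := by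
      rw [measureReal_eq_zero_iff]
      refine measure_mono_null (fun x hx => ?_) h2
      simp only [mem_Ici] at hx
      simp only [Pi.zero_apply, add_zero, sub_zero, mem_compl_iff, mem_ofPred_eq]
      rw [soft_eq hl, max_eq_left (by linarith), max_eq_right (by linarith)]
      nlinarith
    rw [real_Ici_gaussianReal] at h3
    exact (Phi_pos _).ne' h3
  set a : ℝ := 1 / (1 + l) with ha
  have hl1 : 0 < 1 + l := by linarith
  have ha0 : 0 < a := by positivity
  have hal : a * (1 + l) = 1 := by rw [ha]; field_simp
  have h1 : ∫ u in Icc a (2 * a), a ^ 2 * (1 / 3 * (Real.exp (-4) * Real.exp (-l ^ 2 / 2))) ≤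
      ∫ u in Icc a (2 * a), u ^ 2 * gaussianPDFReal 0 1 (u + l) := by
    refine setIntegral_mono_on (integrableOn_const (by simp)) (hI.mono_set fun u hu => ?_)
      measurableSet_Icc fun u hu => ?_
    · exact lt_of_lt_of_le ha0 hu.1
    · rw [gaussianPDFReal_std, ← Real.exp_add]
      have h2 : -4 + -l ^ 2 / 2 ≤ -(u + l) ^ 2 / 2 := by
        have h3 : u * (1 + l) ≤ 2 := by
          have := hu.2
          nlinarith
        have h4 : 0 < u := lt_of_lt_of_le ha0 hu.1
        have h5 : u ≤ 2 := by nlinarith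
        nlinarith
      have h6 : a ^ 2 ≤ u ^ 2 := by
        have := hu.1
        nlinarith
      have := lt_inv_sqrt_two_pi
      have h7 := Real.exp_le_exp.2 h2
      exact mul_le_mul h6 (mul_le_mul this.le h7 (Real.exp_pos _).le (by positivity))
        (by positivity) (sq_nonneg _)
  have h2 : ∫ u in Icc a (2 * a), u ^ 2 * gaussianPDFReal 0 1 (u + l) ≤
      ∫ u in Ioi (0 : ℝ), u ^ 2 * gaussianPDFReal 0 1 (u + l) := by
    refine setIntegral_mono_set hI (ae_of_all _ fun u => ?_)
      (LE.le.eventuallyLE fun u hu => lt_of_lt_of_le ha0 hu.1)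
    exact mul_nonneg (sq_nonneg _) (gaussianPDFReal_nonneg _ _ _)
  rw [setIntegral_const, Real.volume_real_Icc_of_le (by linarith), smul_eq_mul] at h1
  have h8 : Real.exp (-5) ≤ 2 / 3 * Real.exp (-4) := by
    have h9 : Real.exp (-4) = Real.exp (-5) * Real.exp 1 := by rw [← Real.exp_add]; norm_num
    have := Real.exp_one_gt_d9
    nlinarith [Real.exp_pos (-5)]
  have h10 : Real.exp (-5) * Real.exp (-l ^ 2 / 2) / (1 + l) ^ 3 =
      Real.exp (-5) * (Real.exp (-l ^ 2 / 2) * a ^ 3) := by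
    rw [ha]; field_simp
  rw [h10]
  calc _ ≤ 2 / 3 * Real.exp (-4) * (Real.exp (-l ^ 2 / 2) * a ^ 3) := by gcongr
    _ = 2 * ((2 * a - a) * (a ^ 2 * (1 / 3 * (Real.exp (-4) * Real.exp (-l ^ 2 / 2))))) := by ring
    _ ≤ _ := by linarith

/-- For `l ≥ 1` the bias bound suffices, since `l ^ 2 + 1 ≤ 2 * l ^ 2`. For `l ≤ 1` the left side is
at most 2, while the null risk is at least `exp (-6) / 8`. -/
lemma min_sq_add_one_le_softRisk {l : ℝ} (hl : 0 ≤ l) (μ : ℝ) :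
    min (μ ^ 2) (l ^ 2 + 1) ≤ 32 * Real.exp 6 * softRisk μ l := by
  have hR := softRisk_nonneg μ l
  have he : 1 ≤ Real.exp 6 := Real.one_le_exp (by norm_num)
  rcases le_total 1 l with h | h
  · have h1 := min_sq_le_two_mul_softRisk hl μ
    have h2 : min (μ ^ 2) (l ^ 2 + 1) ≤ 2 * min |μ| l ^ 2 := by
      rcases min_cases |μ| l with h3 | h3 <;> rw [h3.1]
      · rw [sq_abs]
        linarith [min_le_left (μ ^ 2) (l ^ 2 + 1), sq_nonneg μ]
      · nlinarith [min_le_right (μ ^ 2) (l ^ 2 + 1)]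
    nlinarith
  · have h1 := (le_softRisk_zero hl).trans (softRisk_zero_le_two_mul hl μ)
    have h2 : Real.exp (-6) / 8 ≤ Real.exp (-5) * Real.exp (-l ^ 2 / 2) / (1 + l) ^ 3 := by
      rw [← Real.exp_add]
      refine div_le_div₀ (Real.exp_pos _).le (Real.exp_le_exp.2 (by nlinarith)) (by positivity) ?_
      calc (1 + l) ^ 3 ≤ 2 ^ 3 := by gcongr; linarith
        _ = 8 := by norm_num
    have h3 : Real.exp 6 * Real.exp (-6) = 1 := by rw [← Real.exp_add]; norm_num
    have h4 : min (μ ^ 2) (l ^ 2 + 1) ≤ 2 := (min_le_right _ _).trans (by nlinarith)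
    nlinarith [Real.exp_pos 6]

/-- Inflating a threshold level by `√(1 + δ)` raises the null risk to the power `1 + δ`, up to a
power of the level. -/
lemma softRisk_zero_sqrt_mul_le {g δ : ℝ} (hg : 0 ≤ g) (hδ : 0 ≤ δ) :
    softRisk 0 (√(1 + δ) * g) ≤
      4 * Real.exp (5 * (1 + δ)) * (1 + g) ^ (3 * δ) * softRisk 0 g ^ (1 + δ) := by
  have hs : 1 ≤ √(1 + δ) := Real.one_le_sqrt.2 (by linarith)
  have hg1 : 0 < 1 + g := by linarith
  have h1 := softRisk_zero_le (l := √(1 + δ) * g) (by positivity)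
  have h2 : Real.exp (-g ^ 2 / 2) ≤ Real.exp 5 * (1 + g) ^ 3 * softRisk 0 g := by
    have := le_softRisk_zero hg
    rw [div_le_iff₀ (by positivity)] at this
    have h5 : Real.exp 5 * Real.exp (-5) = 1 := by rw [← Real.exp_add]; norm_num
    calc Real.exp (-g ^ 2 / 2) = Real.exp 5 * (Real.exp (-5) * Real.exp (-g ^ 2 / 2)) := by
          rw [← mul_assoc, h5, one_mul]
      _ ≤ Real.exp 5 * (softRisk 0 g * (1 + g) ^ 3) := by gcongr
      _ = _ := by ring
  have h3 : Real.exp (-(√(1 + δ) * g) ^ 2 / 2) ≤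
      Real.exp (5 * (1 + δ)) * ((1 + g) ^ 3 * (1 + g) ^ (3 * δ)) * softRisk 0 g ^ (1 + δ) := by
    have h4 : Real.exp (-(√(1 + δ) * g) ^ 2 / 2) = Real.exp (-g ^ 2 / 2) ^ (1 + δ) := by
      rw [← Real.exp_mul, mul_pow, Real.sq_sqrt (by linarith)]
      ring_nf
    have h6 : (1 + g) ^ 3 * (1 + g) ^ (3 * δ) = ((1 + g) ^ 3) ^ (1 + δ) := by
      rw [← Real.rpow_natCast (1 + g) 3, ← Real.rpow_mul hg1.le, ← Real.rpow_add hg1]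
      push_cast
      ring_nf
    rw [h4, h6, Real.exp_mul, ← Real.mul_rpow (by positivity) (by positivity),
      ← Real.mul_rpow (by positivity) (softRisk_nonneg _ _)]
    exact Real.rpow_le_rpow (Real.exp_pos _).le h2 (by linarith)
  refine h1.trans ?_
  have h7 : (1 + g) ^ 3 ≤ (1 + √(1 + δ) * g) ^ 3 := by
    gcongr
    nlinarith
  calc _ ≤ 4 * Real.exp (-(√(1 + δ) * g) ^ 2 / 2) / (1 + g) ^ 3 := by gcongr
    _ ≤ 4 * (Real.exp (5 * (1 + δ)) * ((1 + g) ^ 3 * (1 + g) ^ (3 * δ)) *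
        softRisk 0 g ^ (1 + δ)) / (1 + g) ^ 3 := by gcongr
    _ = _ := by field_simp

end SoftRisk

/-! ### Candidate levels and the step-up and step-down rules. -/

section Levels

lemma Phi_neg_xi {α : ℝ} (hα : 0 < α) (hα' : α < 1) {n k : ℕ} (hn : 1 ≤ n) (hk : 1 ≤ k)
    (hkn : k ≤ n + 1) : Phi (-xi α n k) = α * k / (2 * n) := by
  have hn' : (1 : ℝ) ≤ n := by exact_mod_cast hn
  have hk' : (1 : ℝ) ≤ k := by exact_mod_cast hk
  have hkn' : (k : ℝ) ≤ n + 1 := by exact_mod_cast hkn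
  rw [xi, neg_neg, Phi_PhiInv (by positivity)]
  rw [div_lt_one (by positivity)]
  nlinarith

lemma xi_pos {α : ℝ} (hα : 0 < α) (hα' : α < 1) {n k : ℕ} (hk : 1 ≤ k) (hkn : k ≤ n) :
    0 < xi α n k := by
  have h := Phi_neg_xi hα hα' (hk.trans hkn) hk (hkn.trans n.le_succ)
  have hn' : (0 : ℝ) < n := by exact_mod_cast hk.trans hkn
  have hkn' : (k : ℝ) ≤ n := by exact_mod_cast hkn
  have h1 : Phi (-xi α n k) < Phi 0 := by
    rw [h, Phi_zero, div_lt_div_iff₀ (by positivity) (by norm_num)]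
    nlinarith
  have := strictMono_Phi.lt_iff_lt.1 h1
  linarith

lemma xi_antitone {α : ℝ} (hα : 0 < α) (hα' : α < 1) {n j k : ℕ} (hj : 1 ≤ j) (hjk : j ≤ k)
    (hkn : k ≤ n) : xi α n k ≤ xi α n j := by
  have hn : 1 ≤ n := hj.trans (hjk.trans hkn)
  have h1 : Phi (-xi α n j) ≤ Phi (-xi α n k) := by
    rw [Phi_neg_xi hα hα' hn hj (by omega), Phi_neg_xi hα hα' hn (by omega) (by omega)]
    have : (j : ℝ) ≤ k := by exact_mod_cast hjk
    gcongr
  linarith [strictMono_Phi.le_iff_le.1 h1]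

/-- Passing from `k` to `k + 1` at most doubles the tail probability, whereas a unit shift from a
level above 2 already multiplies it by `exp (3 / 2) ≥ 2`. -/
lemma xi_sub_one_le_succ {α : ℝ} (hα : 0 < α) (hα' : α < 1) {n k : ℕ} (hk : 1 ≤ k)
    (hkn : k ≤ n) (h2 : 2 ≤ xi α n k) : xi α n k - 1 ≤ xi α n (k + 1) := by
  have hn : 1 ≤ n := hk.trans hkn
  have hn' : (1 : ℝ) ≤ n := by exact_mod_cast hn
  have hk' : (1 : ℝ) ≤ k := by exact_mod_cast hk
  have h := exp_mul_Phi_neg_le (xi α n k) zero_le_one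
  have h3 : 2 ≤ Real.exp (xi α n k * 1 - 1 ^ 2 / 2) := by
    have := Real.add_one_le_exp (xi α n k * 1 - 1 ^ 2 / 2)
    linarith
  have h1 : Phi (-xi α n (k + 1)) ≤ Phi (1 - xi α n k) := by
    refine le_trans ?_ h
    refine le_trans ?_ (mul_le_mul_of_nonneg_right h3 (Phi_pos _).le)
    rw [Phi_neg_xi hα hα' hn hk (by omega), Phi_neg_xi hα hα' hn (by omega) (by omega),
      ← mul_div_assoc]
    push_cast
    refine div_le_div_of_nonneg_right ?_ (by positivity)
    nlinarith
  linarith [strictMono_Phi.le_iff_le.1 h1]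

lemma exceedCount_le_succ {n : ℕ} (x : Fin n → ℝ) (s : ℝ) (i : Fin n) :
    exceedCount x s ≤ ((Finset.univ.erase i).filter fun j => s ≤ |x j|).card + 1 := by
  unfold exceedCount
  rw [Finset.filter_erase]
  exact Nat.sub_le_iff_le_add.1 Finset.pred_card_le_card_erase

/-- The count leaves out coordinate `i`, at a loss of at most one exceedance, so that it is
independent of `X i`. -/
lemma exists_xiHat₁_eq (α : ℝ) {n : ℕ} (hn : 1 ≤ n) (x : Fin n → ℝ) :
    ∃ k, 1 ≤ k ∧ k ≤ n ∧ xiHat₁ α x = xi α n k ∧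
      ∀ i, k ≤ ((Finset.univ.erase i).filter fun j => xi α n k ≤ |x j|).card + 1 := by
  classical
  unfold xiHat₁
  split_ifs with h
  · obtain ⟨k, hk, e⟩ := Finset.exists_mem_eq_inf' h (xi α n)
    simp only [Finset.mem_filter, Finset.mem_Icc] at hk
    exact ⟨k, hk.1.1, hk.1.2, e, fun i => hk.2.trans (exceedCount_le_succ _ _ i)⟩
  -- The default level fits the same description: `k = 1` requires no exceedance among the other
  -- coordinates.
  · exact ⟨1, le_rfl, hn, rfl, fun i => by omega⟩

lemma exists_xiHat₂_eq (α : ℝ) {n : ℕ} (hn : 1 ≤ n) (x : Fin n → ℝ) :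
    ∃ k, 1 ≤ k ∧ k ≤ n ∧ xiHat₂ α x = xi α n k ∧ exceedCount x (xi α n (k + 1)) < k + 1 := by
  classical
  unfold xiHat₂
  split_ifs with h
  · obtain ⟨k, hk, e⟩ := Finset.exists_mem_eq_sup' h (xi α n)
    simp only [Finset.mem_filter, Finset.mem_Icc] at hk
    exact ⟨k, hk.1.1, hk.1.2, e, hk.2⟩
  · refine absurd ⟨n, ?_⟩ h
    simp only [Finset.mem_filter, Finset.mem_Icc]
    refine ⟨⟨hn, le_rfl⟩, Nat.lt_succ_of_le ?_⟩
    exact (Finset.card_filter_le _ _).trans (by simp)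

lemma prod_ite_exp {ι : Type*} (s : Finset ι) (p : ι → Prop) [DecidablePred p] (t : ℝ) :
    ∏ j ∈ s, (if p j then Real.exp t else 1) = Real.exp (t * (s.filter p).card) := by
  rw [← Finset.prod_filter, Finset.prod_const, ← Real.exp_nat_mul, mul_comm]

end Levels

/-! ### Pointwise loss bounds for smooth thresholds. -/

section Threshold

variable {κ₀ κ₁ : ℝ} {t : ℝ → ℝ → ℝ}

lemma IsSmoothThreshold.eq_zero (ht : IsSmoothThreshold κ₀ κ₁ t) {l x : ℝ} (hl : 0 ≤ l)
    (hx : |x| ≤ l) : t l x = 0 := by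
  have hs : soft l x = 0 := by
    have := soft_sq hl x
    rw [max_eq_right (by linarith)] at this
    simpa using this
  have hh : hard l x = 0 := if_neg (not_lt.2 hx)
  rcases le_or_gt 0 x with h | h
  · have := ht.between_of_nonneg l x hl h
    rw [hs, hh] at this
    exact le_antisymm this.2 this.1
  · have := ht.between_of_neg l x hl h
    rw [hs, hh] at this
    exact le_antisymm this.2 this.1

/-- The function vanishes at `±l` and has slope at most `κ₀ ≤ 2` beyond. -/
lemma IsSmoothThreshold.abs_le (ht : IsSmoothThreshold κ₀ κ₁ t) (hκ : κ₀ ≤ 2) {l : ℝ} (hl : 0 ≤ l)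
    (x : ℝ) : |t l x| ≤ 2 * max (|x| - l) 0 := by
  rcases le_or_gt |x| l with h | h
  · rw [ht.eq_zero hl h, max_eq_right (by linarith)]
    simp
  · rw [max_eq_left (by linarith)]
    rcases le_or_gt 0 x with h0 | h0
    · rw [abs_of_nonneg h0] at h ⊢
      have h1 := ht.smooth l l x hl h
      rw [ht.eq_zero hl (abs_of_nonneg hl).le] at h1
      rw [abs_of_nonneg (by linarith)]
      nlinarith
    · rw [abs_of_neg h0] at h ⊢
      have h1 := ht.smooth l x (-l) hl (by linarith)
      rw [ht.eq_zero hl (by rw [abs_neg, abs_of_nonneg hl])] at h1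
      rw [abs_of_nonpos (by linarith)]
      nlinarith

lemma IsSmoothThreshold.abs_sub_le (ht : IsSmoothThreshold κ₀ κ₁ t) {l : ℝ} (hl : 0 ≤ l)
    (x : ℝ) : |t l x - x| ≤ l := by
  rcases le_or_gt |x| l with h | h
  · rwa [ht.eq_zero hl h, zero_sub, abs_neg]
  · have hh : hard l x = x := if_pos h
    have hs := soft_eq hl x
    rcases le_or_gt 0 x with h0 | h0
    · have := ht.between_of_nonneg l x hl h0
      rw [hh, hs, max_eq_right (by linarith : -x - l ≤ 0)] at this
      rw [abs_of_nonpos (by linarith)]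
      linarith [le_max_left (x - l) 0]
    · have := ht.between_of_neg l x hl h0
      rw [hh, hs, max_eq_right (by linarith : x - l ≤ 0)] at this
      rw [abs_of_nonneg (by linarith)]
      linarith [le_max_left (-x - l) 0]

/-- Meant for small means: the bound decreases in `l`, so a lower bound on the random level
suffices. -/
lemma IsSmoothThreshold.loss_le_of_small (ht : IsSmoothThreshold κ₀ κ₁ t) (hκ : κ₀ ≤ 2) {l : ℝ}
    (hl : 0 ≤ l) (x θ : ℝ) :
    (t l x - θ) ^ 2 ≤ 16 * max (|x - θ| - l) 0 ^ 2 + 18 * θ ^ 2 := by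
  have h1 := ht.abs_le hκ hl x
  have h2 : max (|x| - l) 0 ≤ max (|x - θ| - l) 0 + |θ| := by
    have h3 : |x| ≤ |x - θ| + |θ| := by
      have := abs_add_le (x - θ) θ
      rwa [sub_add_cancel] at this
    refine max_le ?_ (add_nonneg (le_max_right _ _) (abs_nonneg θ))
    linarith [le_max_left (|x - θ| - l) 0]
  have h4 : 0 ≤ max (|x - θ| - l) 0 := le_max_right _ _
  have h5 : t l x ^ 2 ≤ 4 * (max (|x - θ| - l) 0 + |θ|) ^ 2 := by
    rw [← sq_abs]
    have := abs_nonneg (t l x)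
    nlinarith
  nlinarith [sq_abs θ, sq_nonneg (max (|x - θ| - l) 0 - |θ|), sq_nonneg (t l x + θ)]

/-- Meant for large means: it is free of `θ ^ 2` but needs an upper bound on the random level. -/
lemma IsSmoothThreshold.loss_le_of_large (ht : IsSmoothThreshold κ₀ κ₁ t) {l : ℝ}
    (hl : 0 ≤ l) (x θ : ℝ) : (t l x - θ) ^ 2 ≤ 2 * l ^ 2 + 2 * (x - θ) ^ 2 := by
  have h1 := ht.abs_sub_le hl x
  have h2 : (t l x - x) ^ 2 ≤ l ^ 2 := sq_le_sq.2 (by rwa [abs_of_nonneg hl])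
  nlinarith [sq_nonneg (t l x - x - (x - θ))]

/-- Joint continuity makes the loss at a random level measurable. The level is truncated at 0
because `t` is controlled only for nonnegative levels. -/
lemma IsSmoothThreshold.continuous_uncurry (ht : IsSmoothThreshold κ₀ κ₁ t) :
    Continuous fun p : ℝ × ℝ => t (max p.1 0) p.2 := by
  have hx : ∀ l, 0 ≤ l → ∀ x y, |t l x - t l y| ≤ κ₀ * |x - y| := by
    intro l hl
    have key : ∀ x y, x < y → |t l x - t l y| ≤ κ₀ * |x - y| := by
      intro x y hxy
      have := ht.smooth l x y hl hxy
      rw [abs_of_nonpos (by linarith : t l x - t l y ≤ 0), abs_of_neg (by linarith : x - y < 0)]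
      linarith
    intro x y
    rcases lt_trichotomy x y with h | h | h
    · exact key x y h
    · simp [h]
    · rw [abs_sub_comm, abs_sub_comm x y]
      exact key y x h
  refine continuous_iff_continuousAt.2 fun p => ?_
  refine tendsto_iff_dist_tendsto_zero.2 ?_
  refine squeeze_zero (fun _ => dist_nonneg) (g := fun q : ℝ × ℝ =>
    κ₀ * |q.2 - p.2| + κ₁ * |max q.1 0 - max p.1 0|) (fun q => ?_) ?_
  · rw [Real.dist_eq]
    have h1 := hx (max q.1 0) (le_max_right _ _) q.2 p.2
    have h2 := ht.smooth_level (max q.1 0) (max p.1 0) p.2 (le_max_right _ _) (le_max_right _ _)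
    have h3 := _root_.abs_sub_le (t (max q.1 0) q.2) (t (max q.1 0) p.2) (t (max p.1 0) p.2)
    linarith
  · have hc : Continuous fun q : ℝ × ℝ => κ₀ * |q.2 - p.2| + κ₁ * |max q.1 0 - max p.1 0| := by
      fun_prop
    simpa using hc.tendsto p

end Threshold

/-! ### Exponential moments of exceedance counts. -/

section Chernoff

/-- The exponential weight of an exceedance of the level `s`. -/
noncomputable def expWeight (t s x : ℝ) : ℝ := if s ≤ |x| then Real.exp t else 1

lemma expWeight_pos (t s x : ℝ) : 0 < expWeight t s x := by
  unfold expWeight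
  split_ifs
  · exact Real.exp_pos t
  · exact one_pos

lemma expWeight_le (t s x : ℝ) : expWeight t s x ≤ max (Real.exp t) 1 := by
  unfold expWeight
  split_ifs
  · exact le_max_left _ _
  · exact le_max_right _ _

lemma measurable_expWeight (t s : ℝ) : Measurable (expWeight t s) :=
  Measurable.ite (measurableSet_le measurable_const (by fun_prop)) measurable_const measurable_const

lemma integral_expWeight (θ t s : ℝ) : ∫ x, expWeight t s x ∂(gaussianReal θ 1) =
    1 + (Real.exp t - 1) * (gaussianReal θ 1).real {x | s ≤ |x|} := by
  have hm : MeasurableSet {x : ℝ | s ≤ |x|} := measurableSet_le measurable_const (by fun_prop)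
  have h : ∀ x, expWeight t s x = 1 + {x : ℝ | s ≤ |x|}.indicator (fun _ => Real.exp t - 1) x := by
    intro x
    unfold expWeight
    by_cases hx : s ≤ |x|
    · rw [if_pos hx, Set.indicator_of_mem (by exact hx)]
      ring
    · rw [if_neg hx, Set.indicator_of_notMem (by exact hx)]
      ring
  simp_rw [h]
  rw [integral_add (integrable_const _) ((integrable_const _).indicator hm),
    integral_indicator_const _ hm]
  simp [mul_comm]

variable {n : ℕ} {θ : Fin n → ℝ} {Ω : Type*} [MeasurableSpace Ω] {P : Measure Ω}
  {X : Fin n → Ω → ℝ}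

lemma aemeasurable_prod_expWeight (hlaw : ∀ i, HasLaw (X i) (gaussianReal (θ i) 1) P)
    (J : Finset (Fin n)) (t s : ℝ) :
    AEMeasurable (fun ω => ∏ j ∈ J, expWeight t s (X j ω)) P :=
  Finset.aemeasurable_fun_prod _ fun j _ =>
    (measurable_expWeight t s).comp_aemeasurable (hlaw j).aemeasurable

lemma prod_expWeight_le (J : Finset (Fin n)) (t s : ℝ) (x : Fin n → ℝ) :
    ∏ j ∈ J, expWeight t s (x j) ≤ max (Real.exp t) 1 ^ J.card :=
  (Finset.prod_le_prod (fun _ _ => (expWeight_pos _ _ _).le) fun j _ => expWeight_le t s (x j)).trans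
    (Finset.prod_const _).le

lemma integrable_mul_prod_expWeight (hlaw : ∀ i, HasLaw (X i) (gaussianReal (θ i) 1) P)
    (J : Finset (Fin n)) (t s : ℝ) {f : Ω → ℝ} (hf : Integrable f P) :
    Integrable (fun ω => f ω * ∏ j ∈ J, expWeight t s (X j ω)) P := by
  refine hf.mul_bdd (c := max (Real.exp t) 1 ^ J.card)
    (aemeasurable_prod_expWeight hlaw J t s).aestronglyMeasurable (ae_of_all _ fun ω => ?_)
  rw [Real.norm_of_nonneg (Finset.prod_nonneg fun j _ => (expWeight_pos _ _ _).le)]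
  exact prod_expWeight_le J t s fun j => X j ω

lemma integral_comp_of_hasLaw (hlaw : ∀ i, HasLaw (X i) (gaussianReal (θ i) 1) P) (i : Fin n)
    {h : ℝ → ℝ} (hm : Measurable h) :
    ∫ ω, h (X i ω) ∂P = ∫ x, h x ∂(gaussianReal (θ i) 1) :=
  (hlaw i).integral_comp hm.aestronglyMeasurable

lemma integral_prod_expWeight_le (hX : iIndepFun X P)
    (hlaw : ∀ i, HasLaw (X i) (gaussianReal (θ i) 1) P) (t s : ℝ) :
    ∫ ω, ∏ j, expWeight t s (X j ω) ∂P ≤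
      Real.exp ((Real.exp t - 1) * ∑ j, (gaussianReal (θ j) 1).real {x | s ≤ |x|}) := by
  rw [hX.integral_fun_prod_comp (f := fun _ => expWeight t s) (fun i => (hlaw i).aemeasurable)
    (fun _ => (measurable_expWeight t s).aestronglyMeasurable), Finset.mul_sum, Real.exp_sum]
  refine Finset.prod_le_prod (fun j _ => integral_nonneg fun _ => (expWeight_pos _ _ _).le)
    fun j _ => ?_
  rw [integral_comp_of_hasLaw hlaw j (measurable_expWeight t s), integral_expWeight]
  linarith [Real.add_one_le_exp
    ((Real.exp t - 1) * (gaussianReal (θ j) 1).real {x | s ≤ |x|})]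

/-- Leave-one-out exponential moment bound for the exceedance count. -/
lemma integral_mul_prod_expWeight_le (hX : iIndepFun X P)
    (hlaw : ∀ i, HasLaw (X i) (gaussianReal (θ i) 1) P) (i : Fin n) {t : ℝ} (ht : 0 ≤ t) (s : ℝ)
    {h : ℝ → ℝ} (hm : Measurable h) (h0 : ∀ x, 0 ≤ h x) :
    ∫ ω, h (X i ω) * ∏ j ∈ Finset.univ.erase i, expWeight t s (X j ω) ∂P ≤
      (∫ x, h x ∂(gaussianReal (θ i) 1)) *
        Real.exp ((Real.exp t - 1) * ∑ j, (gaussianReal (θ j) 1).real {x | s ≤ |x|}) := by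
  have he : 0 ≤ Real.exp t - 1 := by linarith [Real.one_le_exp ht]
  let f : Fin n → ℝ → ℝ := fun j => if j = i then h else expWeight t s
  have hfm : ∀ j, Measurable (f j) := by
    intro j
    by_cases hj : j = i
    · simpa [f, hj] using hm
    · simpa [f, hj] using measurable_expWeight t s
  have hprod : ∀ a : Fin n → (ℝ → ℝ) → ℝ, ∏ j, a j (f j) =
      a i h * ∏ j ∈ Finset.univ.erase i, a j (expWeight t s) := by
    intro a
    rw [← Finset.mul_prod_erase _ _ (Finset.mem_univ i)]
    congr 1
    · simp [f]
    · exact Finset.prod_congr rfl fun j hj => by simp [f, Finset.ne_of_mem_erase hj]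
  have e1 : ∀ ω, h (X i ω) * ∏ j ∈ Finset.univ.erase i, expWeight t s (X j ω) =
      ∏ j, f j (X j ω) := fun ω => (hprod fun j u => u (X j ω)).symm
  simp_rw [e1]
  rw [hX.integral_fun_prod_comp (fun i => (hlaw i).aemeasurable)
    (fun j => (hfm j).aestronglyMeasurable), hprod fun j u => ∫ ω, u (X j ω) ∂P,
    integral_comp_of_hasLaw hlaw i hm]
  refine mul_le_mul_of_nonneg_left ?_ (integral_nonneg h0)
  calc ∏ j ∈ Finset.univ.erase i, ∫ ω, expWeight t s (X j ω) ∂P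
      ≤ ∏ j ∈ Finset.univ.erase i,
        Real.exp ((Real.exp t - 1) * (gaussianReal (θ j) 1).real {x | s ≤ |x|}) := by
        refine Finset.prod_le_prod
          (fun j _ => integral_nonneg fun _ => (expWeight_pos _ _ _).le) fun j _ => ?_
        rw [integral_comp_of_hasLaw hlaw j (measurable_expWeight t s), integral_expWeight]
        linarith [Real.add_one_le_exp
          ((Real.exp t - 1) * (gaussianReal (θ j) 1).real {x | s ≤ |x|})]
    _ ≤ ∏ j, Real.exp ((Real.exp t - 1) * (gaussianReal (θ j) 1).real {x | s ≤ |x|}) :=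
        Finset.prod_le_prod_of_subset_of_one_le (Finset.erase_subset _ _)
          (fun j _ => (Real.exp_pos _).le)
          fun j _ _ => Real.one_le_exp (mul_nonneg he measureReal_nonneg)
    _ = _ := by rw [Finset.mul_sum, Real.exp_sum]

lemma integral_centered (θ : ℝ) (f : ℝ → ℝ) :
    ∫ x, f (x - θ) ∂(gaussianReal θ 1) = ∫ x, f x ∂(gaussianReal 0 1) := by
  have h : (gaussianReal 0 1).map (MeasurableEquiv.addRight θ) = gaussianReal θ 1 := by
    have := gaussianReal_map_add_const (μ := 0) (v := 1) θ
    rwa [zero_add] at this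
  rw [← h, integral_map_equiv]
  simp

lemma integrable_centered_sq (hlaw : ∀ i, HasLaw (X i) (gaussianReal (θ i) 1) P) (i : Fin n) :
    Integrable (fun ω => (X i ω - θ i) ^ 2) P := by
  have h := gaussianReal_sub_const (hlaw i) (θ i)
  have h2 := integrable_sq_gaussianReal (θ i - θ i) 1
  rw [← h.map_eq] at h2
  exact (integrable_map_measure (by fun_prop) h.aemeasurable).1 h2

lemma integral_centered_sq (hlaw : ∀ i, HasLaw (X i) (gaussianReal (θ i) 1) P) (i : Fin n) :
    ∫ ω, (X i ω - θ i) ^ 2 ∂P = 1 := by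
  rw [integral_comp_of_hasLaw hlaw i (h := fun x => (x - θ i) ^ 2) (by fun_prop),
    integral_centered (θ i) (fun x => x ^ 2)]
  have := variance_fun_id_gaussianReal (μ := 0) (v := 1)
  rw [variance_of_integral_eq_zero (by fun_prop) (by simp)] at this
  simpa using this

lemma integrable_excess_sq (hlaw : ∀ i, HasLaw (X i) (gaussianReal (θ i) 1) P) (i : Fin n)
    {l : ℝ} (hl : 0 ≤ l) : Integrable (fun ω => max (|X i ω - θ i| - l) 0 ^ 2) P := by
  have hm : Measurable fun x => max (|x - θ i| - l) 0 ^ 2 := by fun_prop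
  refine (integrable_centered_sq hlaw i).mono'
    (hm.comp_aemeasurable (hlaw i).aemeasurable).aestronglyMeasurable (ae_of_all _ fun ω => ?_)
  rw [Real.norm_of_nonneg (sq_nonneg _), ← sq_abs (X i ω - θ i)]
  exact pow_le_pow_left₀ (le_max_right _ _)
    (max_le (by linarith) (abs_nonneg _)) 2

lemma integral_excess_sq (θ : ℝ) {l : ℝ} (hl : 0 ≤ l) :
    ∫ x, max (|x - θ| - l) 0 ^ 2 ∂(gaussianReal θ 1) = softRisk 0 l := by
  rw [softRisk_zero_eq hl, integral_centered θ (fun x => max (|x| - l) 0 ^ 2)]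

/-- An exponential tilt for which the exceedances of the null coordinates are negligible. -/
lemma exists_tilt {α : ℝ} (h0 : 0 < α) (h1 : α < 1) :
    ∃ t c : ℝ, 0 < t ∧ t ≤ 1 ∧ 0 < c ∧ (Real.exp t - 1) * α ≤ t - c := by
  -- From `exp t - 1 ≤ t / (1 - t)`: this `t` makes `α / (1 - t) = (1 + α) / 2`, leaving the margin
  -- `c = t (1 - α) / 2`.
  refine ⟨(1 - α) / (1 + α), (1 - α) / (1 + α) * ((1 - α) / 2), by
    have : 0 < 1 - α := by linarith
    positivity, by rw [div_le_one (by linarith)]; linarith, by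
    have : 0 < 1 - α := by linarith
    positivity, ?_⟩
  set t := (1 - α) / (1 + α) with ht
  have ht0 : 0 < t := by
    have : 0 < 1 - α := by linarith
    positivity
  have h2 : (1 - t) * (1 + α) = 2 * α := by rw [ht]; field_simp; ring
  have h3 : (1 - t) * Real.exp t ≤ 1 := by
    have := Real.add_one_le_exp (-t)
    have h4 : Real.exp (-t) * Real.exp t = 1 := by rw [← Real.exp_add]; simp
    nlinarith [Real.exp_pos t]
  have h5 : (1 - t) * (Real.exp t - 1) ≤ t := by linarith
  have h6 : α = (1 - t) * (1 + α) / 2 := by linarith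
  calc (Real.exp t - 1) * α = (1 - t) * (Real.exp t - 1) * ((1 + α) / 2) := by
        linear_combination (Real.exp t - 1) * h6
    _ ≤ t * ((1 + α) / 2) := by gcongr
    _ = _ := by ring

end Chernoff

/-! ### Noise above the step-up level and size of the step-down level. -/

section LevelBounds

variable {n : ℕ} {θ : Fin n → ℝ} {Ω : Type*} [MeasurableSpace Ω] {P : Measure Ω}
  {X : Fin n → Ω → ℝ}

/-- The levels are calibrated so that `n` null coordinates contribute exactly `α k`. -/
lemma sum_exceed_prob_le {α : ℝ} (hα : 0 < α) (hα' : α < 1) {k : ℕ} (hk : 1 ≤ k) (hkn : k ≤ n) :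
    ∑ j, (gaussianReal (θ j) 1).real {x | xi α n k ≤ |x|} ≤ α * k + ∑ j, min (θ j ^ 2) 1 := by
  have hn : (0 : ℝ) < n := by exact_mod_cast hk.trans hkn
  calc _ ≤ ∑ j, (2 * Phi (-xi α n k) + min (θ j ^ 2) 1) :=
        Finset.sum_le_sum fun j _ => real_abs_ge_gaussianReal_le (θ j) (xi_pos hα hα' hk hkn)
    _ = _ := by
        rw [Finset.sum_add_distrib, Phi_neg_xi hα hα' (hk.trans hkn) hk (by omega)]
        simp only [Finset.sum_const, Finset.card_univ, Fintype.card_fin, nsmul_eq_mul]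
        congr 1
        field_simp

/-- The noise that survives a threshold above `G ξ̂₁` is dominated by an integrable variable. For
`K ≥ 1`, levels up to `K` are treated jointly by monotonicity of `G`. -/
lemma exists_noise_bound (hX : iIndepFun X P)
    (hlaw : ∀ i, HasLaw (X i) (gaussianReal (θ i) 1) P) {α α' t c : ℝ} (hα : 0 < α)
    (hαα' : α ≤ α') (hα' : α' < 1) (ht : 0 < t) (ht1 : t ≤ 1)
    (htc : (Real.exp t - 1) * α' ≤ t - c) {G : ℝ → ℝ} (hG : ∀ x, 0 < x → 0 ≤ G x) {K : ℕ}
    (hK : K = 0 ∨ K ≤ n ∧ MonotoneOn G (Set.Ioi 0)) (i : Fin n) :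
    ∃ Y : Ω → ℝ, Integrable Y P ∧
      (∀ ω l, G (xiHat₁ α fun j => X j ω) ≤ l → max (|X i ω - θ i| - l) 0 ^ 2 ≤ Y ω) ∧
      ∫ ω, Y ω ∂P ≤ (if K = 0 then 0 else softRisk 0 (G (xi α n K))) +
        ∑ k ∈ Finset.Ioc K n, softRisk 0 (G (xi α n k)) *
          Real.exp (1 + 2 * ∑ j, min (θ j ^ 2) 1 - c * k) := by
  have hα1 : α < 1 := hαα'.trans_lt hα'
  have hn : 1 ≤ n := by
    have := i.2
    omega
  have hGk : ∀ k, 1 ≤ k → k ≤ n → 0 ≤ G (xi α n k) := fun k h1 h2 => hG _ (xi_pos hα hα1 h1 h2)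
  let h : ℕ → ℝ → ℝ := fun k x => max (|x - θ i| - G (xi α n k)) 0 ^ 2
  have hh0 : ∀ k x, 0 ≤ h k x := fun k x => sq_nonneg _
  have hhm : ∀ k, Measurable (h k) := fun k => by fun_prop
  -- The factor multiplying `h k (X i ω)` is at least 1 as soon as `k - 1` other coordinates exceed
  -- `ξ_k`; it replaces the indicator of `ξ̂₁ = ξ_k` and is independent of `X i`.
  let W : ℕ → Ω → ℝ := fun k ω => Real.exp (-t * (k - 1)) * (h k (X i ω) *
    ∏ j ∈ Finset.univ.erase i, expWeight t (xi α n k) (X j ω))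
  have hW0 : ∀ k ω, 0 ≤ W k ω := fun k ω => mul_nonneg (Real.exp_pos _).le
    (mul_nonneg (hh0 _ _) (Finset.prod_nonneg fun j _ => (expWeight_pos _ _ _).le))
  have hWi : ∀ k ∈ Finset.Ioc K n, Integrable (W k) P := by
    intro k hk
    rw [Finset.mem_Ioc] at hk
    exact (integrable_mul_prod_expWeight hlaw _ _ _
      (integrable_excess_sq hlaw i (hGk k (by omega) hk.2))).const_mul _
  let V : Ω → ℝ := fun ω => if K = 0 then 0 else h K (X i ω)
  have hV0 : ∀ ω, 0 ≤ V ω := by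
    intro ω
    simp only [V]
    split_ifs
    · exact le_rfl
    · exact hh0 _ _
  have hVi : Integrable V P := by
    by_cases h0 : K = 0
    · simp only [V, if_pos h0]
      exact integrable_zero _ _ _
    · simp only [V, h0, if_false]
      exact integrable_excess_sq hlaw i
        (hGk K (by omega) (hK.resolve_left h0).1)
  refine ⟨fun ω => V ω + ∑ k ∈ Finset.Ioc K n, W k ω, hVi.add (integrable_finsetSum _ hWi), ?_, ?_⟩
  · intro ω l hl
    obtain ⟨k, hk1, hkn, e, hc⟩ := exists_xiHat₁_eq α hn fun j => X j ω
    rw [e] at hl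
    have h1 : max (|X i ω - θ i| - l) 0 ^ 2 ≤ h k (X i ω) :=
      pow_le_pow_left₀ (le_max_right _ _) (max_le_max_right _ (by linarith)) 2
    by_cases hkK : k ≤ K
    · have h0 : K ≠ 0 := by omega
      obtain ⟨hKn, hmono⟩ := hK.resolve_left h0
      have h2 : G (xi α n K) ≤ G (xi α n k) := hmono (xi_pos hα hα1 (by omega) hKn)
        (xi_pos hα hα1 hk1 hkn) (xi_antitone hα hα1 hk1 hkK hKn)
      have h3 : h k (X i ω) ≤ V ω := by
        simp only [V, h0, if_false, h]
        exact pow_le_pow_left₀ (le_max_right _ _) (max_le_max_right _ (by linarith)) 2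
      exact (h1.trans h3).trans (le_add_of_nonneg_right (Finset.sum_nonneg fun k _ => hW0 k ω))
    · have h3 : h k (X i ω) ≤ W k ω := by
        simp only [W]
        rw [mul_left_comm]
        refine le_mul_of_one_le_right (hh0 _ _) ?_
        unfold expWeight
        rw [prod_ite_exp, ← Real.exp_add]
        refine Real.one_le_exp ?_
        have h4 : (k : ℝ) ≤
            ((Finset.univ.erase i).filter fun j => xi α n k ≤ |X j ω|).card + 1 := by
          exact_mod_cast hc i
        nlinarith
      have h5 : W k ω ≤ ∑ k ∈ Finset.Ioc K n, W k ω :=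
        Finset.single_le_sum (f := fun k => W k ω) (fun k _ => hW0 k ω)
          (Finset.mem_Ioc.2 ⟨by omega, hkn⟩)
      linarith [hV0 ω]
  · rw [integral_add hVi (integrable_finsetSum _ hWi), integral_finsetSum _ hWi]
    refine add_le_add ?_ (Finset.sum_le_sum fun k hk => ?_)
    · by_cases h0 : K = 0
      · simp [V, h0]
      · simp only [V, h0, if_false]
        rw [integral_comp_of_hasLaw hlaw i (hhm K)]
        exact (integral_excess_sq (θ i) (hGk K (by omega) (hK.resolve_left h0).1)).le
    · rw [Finset.mem_Ioc] at hk
      have hk1 : 1 ≤ k := by omega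
      have h1 := integral_mul_prod_expWeight_le hX hlaw i ht.le (xi α n k) (hhm k) (hh0 k)
      rw [integral_excess_sq (θ i) (hGk k hk1 hk.2)] at h1
      simp only [W]
      rw [integral_const_mul]
      refine (mul_le_mul_of_nonneg_left h1 (Real.exp_pos _).le).trans ?_
      rw [mul_left_comm, ← Real.exp_add]
      refine mul_le_mul_of_nonneg_left (Real.exp_le_exp.2 ?_) (softRisk_nonneg _ _)
      have h2 := sum_exceed_prob_le (θ := θ) hα hα1 hk1 hk.2
      -- The exponent is `-t (k - 1) + (exp t - 1)(α k + B) ≤ t - c k + 2 B`, and `t ≤ 1`.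
      set B := ∑ j, min (θ j ^ 2) 1 with hB
      have hB0 : 0 ≤ B := Finset.sum_nonneg fun j _ => le_min (sq_nonneg _) zero_le_one
      have he0 : 0 ≤ Real.exp t - 1 := by linarith [Real.one_le_exp ht.le]
      have he2 : Real.exp t - 1 ≤ 2 := by
        have h3 := Real.exp_le_exp.2 ht1
        have h4 := Real.exp_one_lt_d9
        linarith
      have hk0 : (0 : ℝ) ≤ k := k.cast_nonneg
      have h5 := mul_le_mul_of_nonneg_left h2 he0
      have h6 : (Real.exp t - 1) * (α * k) ≤ (t - c) * k := by
        rw [← mul_assoc]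
        refine mul_le_mul_of_nonneg_right (le_trans ?_ htc) hk0
        exact mul_le_mul_of_nonneg_left hαα' he0
      have h7 : (Real.exp t - 1) * B ≤ 2 * B := mul_le_mul_of_nonneg_right he2 hB0
      linarith

lemma sum_exp_neg_succ_le (n : ℕ) : ∑ k ∈ Finset.Icc 1 n, Real.exp (-(k + 1 : ℝ)) ≤ 1 := by
  have h1 : ∀ k : ℕ, Real.exp (-(k + 1 : ℝ)) ≤ (1 / 2 : ℝ) ^ (k + 1) := by
    intro k
    have : Real.exp (-(k + 1 : ℝ)) = Real.exp (-1) ^ (k + 1) := by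
      rw [← Real.exp_nat_mul]
      push_cast
      ring_nf
    rw [this]
    refine pow_le_pow_left₀ (Real.exp_pos _).le ?_ _
    rw [Real.exp_neg, one_div]
    have := Real.exp_one_gt_d9
    gcongr
    linarith
  have h2 : ∀ n : ℕ, ∑ k ∈ Finset.Icc 1 n, (1 / 2 : ℝ) ^ (k + 1) ≤ 1 - (1 / 2 : ℝ) ^ n := by
    intro n
    induction n with
    | zero => simp
    | succ m ih =>
      rw [Finset.sum_Icc_succ_top (by omega)]
      have : (0 : ℝ) < (1 / 2) ^ m := by positivity
      rw [pow_succ, pow_succ]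
      linarith
  have h3 : (0 : ℝ) < (1 / 2) ^ n := by positivity
  linarith [Finset.sum_le_sum fun k (_ : k ∈ Finset.Icc 1 n) => h1 k, h2 n]

/-- Each mean beyond `m` multiplies the tail `Φ(-ξ) = α k / (2 n)` by at least `exp (ξ m - m² / 2)`.
With `D n exp (-m² / 2)` such means the total is `(D α / 2) k exp (m (ξ - m))`, and `m ≥ 1`. -/
lemma le_sum_exceed_prob {α D : ℝ} (hα : 0 < α) (hα1 : α < 1) (hD : 8 ≤ D * α) {m : ℕ}
    (hm : 1 ≤ m)
    (hF : D * n * Real.exp (-(m : ℝ) ^ 2 / 2) ≤ (Finset.univ.filter fun i => (m : ℝ) ≤ |θ i|).card)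
    {k : ℕ} (hk : 1 ≤ k) (hkn : k ≤ n + 1) (hn : 1 ≤ n) (hxm : m ≤ xi α n k) :
    4 * k * Real.exp (xi α n k - m) ≤
      ∑ j, (gaussianReal (θ j) 1).real {x | xi α n k ≤ |x|} := by
  set ξ := xi α n k with hξ
  have hm' : (1 : ℝ) ≤ m := by exact_mod_cast hm
  have hn' : (0 : ℝ) < n := by exact_mod_cast hn
  have hk' : (0 : ℝ) < k := by exact_mod_cast hk
  have hP := Phi_neg_xi hα hα1 hn hk hkn
  rw [← hξ] at hP
  calc 4 * k * Real.exp (ξ - m)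
      ≤ D * α / 2 * k * Real.exp (ξ * m - m ^ 2) := by
        refine mul_le_mul (by nlinarith) (Real.exp_le_exp.2 (by nlinarith)) (Real.exp_pos _).le
          (by positivity)
    _ = D * n * Real.exp (-(m : ℝ) ^ 2 / 2) *
          (Real.exp (ξ * m - (m : ℝ) ^ 2 / 2) * Phi (-ξ)) := by
        have : Real.exp (ξ * m - m ^ 2) =
            Real.exp (-(m : ℝ) ^ 2 / 2) * Real.exp (ξ * m - (m : ℝ) ^ 2 / 2) := by
          rw [← Real.exp_add]
          ring_nf
        rw [hP, this]
        field_simp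
    _ ≤ (Finset.univ.filter fun i => (m : ℝ) ≤ |θ i|).card *
          (Real.exp (ξ * m - (m : ℝ) ^ 2 / 2) * Phi (-ξ)) :=
        mul_le_mul_of_nonneg_right hF (mul_nonneg (Real.exp_pos _).le (Phi_pos _).le)
    _ = ∑ j ∈ Finset.univ.filter fun i => (m : ℝ) ≤ |θ i|,
          Real.exp (ξ * m - (m : ℝ) ^ 2 / 2) * Phi (-ξ) := by
        rw [Finset.sum_const, nsmul_eq_mul]
    _ ≤ ∑ j ∈ Finset.univ.filter fun i => (m : ℝ) ≤ |θ i|,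
          (gaussianReal (θ j) 1).real {x | ξ ≤ |x|} :=
        Finset.sum_le_sum fun j hj => le_real_abs_ge_gaussianReal (by linarith) (by linarith)
          (Finset.mem_filter.1 hj).2
    _ ≤ _ := Finset.sum_le_sum_of_subset_of_nonneg (Finset.filter_subset _ _)
        fun _ _ _ => measureReal_nonneg

/-- If sufficiently many means exceed `m`, the step-down level is of order `m` in `L²`. -/
lemma exists_xiHat₂_bound [IsProbabilityMeasure P] (hX : iIndepFun X P)
    (hlaw : ∀ i, HasLaw (X i) (gaussianReal (θ i) 1) P) {α D : ℝ} (hα : 0 < α) (hα1 : α < 1)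
    (hD : 8 ≤ D * α) (hn : 1 ≤ n) {m : ℕ} (hm : 1 ≤ m)
    (hF : D * n * Real.exp (-(m : ℝ) ^ 2 / 2) ≤
      (Finset.univ.filter fun i => (m : ℝ) ≤ |θ i|).card) :
    ∃ Y : Ω → ℝ, Integrable Y P ∧ (∀ ω, xiHat₂ α (fun j => X j ω) ^ 2 ≤ Y ω) ∧
      ∫ ω, Y ω ∂P ≤ 14 * (m : ℝ) ^ 2 := by
  classical
  have hm' : (1 : ℝ) ≤ m := by exact_mod_cast hm
  let T := (Finset.Icc 1 n).filter fun k => (m : ℝ) + 1 < xi α n k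
  -- A tilt by `-1`: when at most `k + 1` coordinates exceed `ξ_{k+1}`, the weight multiplying
  -- `ξ_k²` is at least 1.
  let W : ℕ → Ω → ℝ := fun k ω => xi α n k ^ 2 * Real.exp (k + 1) *
    ∏ j, expWeight (-1) (xi α n (k + 1)) (X j ω)
  have hW0 : ∀ k ω, 0 ≤ W k ω := fun k ω => mul_nonneg (by positivity)
    (Finset.prod_nonneg fun j _ => (expWeight_pos _ _ _).le)
  have hWi : ∀ k ∈ T, Integrable (W k) P := fun k _ =>
    integrable_mul_prod_expWeight hlaw _ _ _ (integrable_const _)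
  refine ⟨fun ω => ((m : ℝ) + 1) ^ 2 + ∑ k ∈ T, W k ω,
    (integrable_const _).add (integrable_finsetSum _ hWi), ?_, ?_⟩
  · intro ω
    obtain ⟨k, hk1, hkn, e, hc⟩ := exists_xiHat₂_eq α hn fun j => X j ω
    rw [e]
    have hpos := xi_pos hα hα1 hk1 hkn
    by_cases hk : (m : ℝ) + 1 < xi α n k
    · have h1 : xi α n k ^ 2 ≤ W k ω := by
        simp only [W]
        rw [mul_assoc]
        refine le_mul_of_one_le_right (sq_nonneg _) ?_
        unfold expWeight
        rw [prod_ite_exp, ← Real.exp_add]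
        refine Real.one_le_exp ?_
        unfold exceedCount at hc
        have h4 : ((Finset.univ.filter fun j => xi α n (k + 1) ≤ |X j ω|).card : ℝ) ≤ k + 1 := by
          exact_mod_cast hc.le
        linarith
      have h5 : W k ω ≤ ∑ k ∈ T, W k ω :=
        Finset.single_le_sum (f := fun k => W k ω) (fun k _ => hW0 k ω)
          (Finset.mem_filter.2 ⟨Finset.mem_Icc.2 ⟨hk1, hkn⟩, hk⟩)
      nlinarith
    · have h1 : xi α n k ^ 2 ≤ ((m : ℝ) + 1) ^ 2 :=
        pow_le_pow_left₀ hpos.le (not_lt.1 hk) 2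
      linarith [Finset.sum_nonneg fun k (_ : k ∈ T) => hW0 k ω]
  · rw [integral_add (integrable_const _) (integrable_finsetSum _ hWi), integral_finsetSum _ hWi]
    have hterm : ∀ k ∈ T, ∫ ω, W k ω ∂P ≤
        (2 * ((m : ℝ) + 1) ^ 2 + 2) * Real.exp (-(k + 1 : ℝ)) := by
      intro k hk
      obtain ⟨hk, hkm⟩ := Finset.mem_filter.1 hk
      obtain ⟨hk1, hkn⟩ := Finset.mem_Icc.1 hk
      have hk1' : (1 : ℝ) ≤ k := by exact_mod_cast hk1
      have hstep := xi_sub_one_le_succ hα hα1 hk1 hkn (by linarith)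
      have hS := le_sum_exceed_prob hα hα1 hD hm hF (k := k + 1) (by omega) (by omega) hn
        (by linarith)
      have h1 := integral_prod_expWeight_le hX hlaw (-1) (xi α n (k + 1))
      set S := ∑ j, (gaussianReal (θ j) 1).real {x | xi α n (k + 1) ≤ |x|} with hSdef
      set u := xi α n (k + 1) - m with hu
      have hu0 : 0 ≤ u := by linarith
      push_cast at hS
      have hexp : Real.exp (-1) - 1 ≤ -(1 / 2) := by
        rw [Real.exp_neg]
        have h2 := Real.exp_one_gt_d9
        have : (Real.exp 1)⁻¹ ≤ (2 : ℝ)⁻¹ := by gcongr; linarith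
        linarith
      have hS0 : 0 ≤ S := Finset.sum_nonneg fun _ _ => measureReal_nonneg
      -- The expected count at `ξ_{k+1} = m + u` is at least `4 (k + 1)(1 + u)`. The resulting decay
      -- beats both the factor `exp (k + 1)` and the growth of `ξ_k² ≤ (m + 1 + u)²`.
      have h2 : (Real.exp (-1) - 1) * S ≤ -(2 * (k + 1) + 2 * (k + 1) * u) := by
        have h3 := Real.add_one_le_exp u
        have h4 : 4 * (k + 1 : ℝ) * (u + 1) ≤ S := by
          refine le_trans ?_ hS
          gcongr
        nlinarith
      have h5 : xi α n k ^ 2 ≤ (2 * ((m : ℝ) + 1) ^ 2 + 2) * Real.exp (2 * u) := by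
        have h6 : xi α n k ≤ (m + 1) + u := by linarith
        have h7 : 0 ≤ xi α n k := by linarith
        have h8 := Real.add_one_le_exp u
        have h9 : Real.exp (2 * u) = Real.exp u ^ 2 := by rw [← Real.exp_nat_mul]; norm_num
        have h10 : 1 + u ^ 2 ≤ Real.exp (2 * u) := by
          rw [h9]
          nlinarith
        have h11 : xi α n k ^ 2 ≤ ((m + 1) + u) ^ 2 := pow_le_pow_left₀ h7 h6 2
        nlinarith [sq_nonneg ((m : ℝ) + 1 - u), sq_nonneg u, sq_nonneg ((m : ℝ) + 1)]
      simp only [W]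
      rw [integral_const_mul]
      calc _ ≤ xi α n k ^ 2 * Real.exp (k + 1) *
            Real.exp (-(2 * (k + 1) + 2 * (k + 1) * u)) := by
            refine mul_le_mul_of_nonneg_left (h1.trans (Real.exp_le_exp.2 h2)) (by positivity)
        _ = xi α n k ^ 2 * Real.exp (-(k + 1) - 2 * (k + 1) * u) := by
            rw [mul_assoc, ← Real.exp_add]
            ring_nf
        _ ≤ (2 * ((m : ℝ) + 1) ^ 2 + 2) * Real.exp (2 * u) *
            Real.exp (-(k + 1) - 2 * (k + 1) * u) := by
            exact mul_le_mul_of_nonneg_right h5 (Real.exp_pos _).le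
        _ ≤ _ := by
            rw [mul_assoc, ← Real.exp_add]
            refine mul_le_mul_of_nonneg_left (Real.exp_le_exp.2 ?_) (by positivity)
            nlinarith
    have hsum : ∑ k ∈ T, ∫ ω, W k ω ∂P ≤ (2 * ((m : ℝ) + 1) ^ 2 + 2) * 1 := by
      refine (Finset.sum_le_sum hterm).trans ?_
      rw [← Finset.mul_sum]
      refine mul_le_mul_of_nonneg_left (le_trans ?_ (sum_exp_neg_succ_le n)) (by positivity)
      exact Finset.sum_le_sum_of_subset_of_nonneg (Finset.filter_subset _ _)
        fun _ _ _ => (Real.exp_pos _).le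
    -- The total is `3 (m + 1)² + 2`, at most `14 m²` since `m ≥ 1`.
    simp only [integral_const, probReal_univ, one_smul]
    nlinarith

end LevelBounds

/-! ### Truncated squared means against the soft threshold risk. -/

section Bias

/-- Moving the Gaussian exponent by 2 gains a factor beyond `exp (-(1 + l))`, which absorbs the
polynomial `(1 + l) ^ 3` of the null risk. -/
lemma exp_neg_add_two_sq_le {l : ℝ} (hl : 0 ≤ l) :
    Real.exp (-(l + 2) ^ 2 / 2) ≤ 6 * Real.exp 5 * softRisk 0 l := by
  have h1 := le_softRisk_zero hl
  rw [div_le_iff₀ (by positivity)] at h1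
  have h2 : (1 + l) ^ 3 ≤ 6 * Real.exp (1 + l) := by
    have := Real.pow_div_factorial_le_exp (1 + l) (by linarith) 3
    have h3 : ((3 : ℕ).factorial : ℝ) = 6 := by norm_num [Nat.factorial]
    rw [h3, div_le_iff₀ (by norm_num)] at this
    linarith
  have h4 : Real.exp (-(l + 2) ^ 2 / 2) * Real.exp (1 + l) ≤ Real.exp (-l ^ 2 / 2) := by
    rw [← Real.exp_add]
    exact Real.exp_le_exp.2 (by nlinarith)
  have h5 : Real.exp 5 * Real.exp (-5) = 1 := by rw [← Real.exp_add]; norm_num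
  have h6 : 0 < (1 + l) ^ 3 := by positivity
  have hR := softRisk_nonneg 0 l
  have h7 : Real.exp (-(l + 2) ^ 2 / 2) * (1 + l) ^ 3 ≤
      6 * Real.exp 5 * softRisk 0 l * (1 + l) ^ 3 := by
    calc _ ≤ Real.exp (-(l + 2) ^ 2 / 2) * (6 * Real.exp (1 + l)) := by gcongr
      _ ≤ 6 * Real.exp (-l ^ 2 / 2) := by linarith
      _ = 6 * (Real.exp 5 * (Real.exp (-5) * Real.exp (-l ^ 2 / 2))) := by
        rw [← mul_assoc (Real.exp 5), h5, one_mul]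
      _ ≤ 6 * (Real.exp 5 * (softRisk 0 l * (1 + l) ^ 3)) := by gcongr
      _ = _ := by ring
  exact le_of_mul_le_mul_right h7 h6

/-- Telescoping `(j + 1)² - j² = 2 j + 1`; the step from `j` counts only if `|θ|` reaches `j`. -/
lemma min_sq_le_add_sum (θ : ℝ) {m₀ m : ℕ} (h : m₀ ≤ m) :
    min (θ ^ 2) ((m : ℝ) ^ 2) ≤ min (θ ^ 2) ((m₀ : ℝ) ^ 2) +
      ∑ j ∈ Finset.Ico m₀ m, if (j : ℝ) ≤ |θ| then 2 * (j : ℝ) + 1 else 0 := by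
  induction m, h using Nat.le_induction with
  | base => simp
  | succ m hm ih =>
    rw [Finset.sum_Ico_succ_top hm]
    have hm0 : (0 : ℝ) ≤ m := m.cast_nonneg
    push_cast
    split_ifs with hj
    · have : min (θ ^ 2) (((m : ℝ) + 1) ^ 2) ≤ min (θ ^ 2) ((m : ℝ) ^ 2) + (2 * m + 1) := by
        rcases min_cases (θ ^ 2) ((m : ℝ) ^ 2) with h | h <;> rw [h.1]
        · linarith [min_le_left (θ ^ 2) (((m : ℝ) + 1) ^ 2)]
        · linarith [min_le_right (θ ^ 2) (((m : ℝ) + 1) ^ 2)]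
      linarith
    · have : min (θ ^ 2) (((m : ℝ) + 1) ^ 2) ≤ min (θ ^ 2) ((m : ℝ) ^ 2) := by
        have h1 : θ ^ 2 ≤ (m : ℝ) ^ 2 := by
          rw [← sq_abs]
          exact pow_le_pow_left₀ (abs_nonneg θ) (not_le.1 hj).le 2
        rw [min_eq_left h1]
        exact min_le_left _ _
      linarith

/-- The right side telescopes: `exp (-(m - 1)² / 2)` is at least `(m + 1/2) exp (-m² / 2)`, and `6
(m - 1/2) ≥ 2 m + 1` for `m ≥ 1`. -/
lemma sum_mul_exp_neg_sq_le {m₀ m : ℕ} (h0 : 1 ≤ m₀) (h : m₀ ≤ m) :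
    ∑ j ∈ Finset.Ico m₀ m, (2 * (j : ℝ) + 1) * Real.exp (-(j : ℝ) ^ 2 / 2) ≤
      6 * Real.exp (-((m₀ : ℝ) - 1) ^ 2 / 2) - 6 * Real.exp (-((m : ℝ) - 1) ^ 2 / 2) := by
  induction m, h using Nat.le_induction with
  | base => simp
  | succ m hm ih =>
    rw [Finset.sum_Ico_succ_top hm]
    have hm1 : (1 : ℝ) ≤ m := by exact_mod_cast h0.trans hm
    have h1 : Real.exp (-((m : ℝ) - 1) ^ 2 / 2) =
        Real.exp (m - 1 / 2) * Real.exp (-(m : ℝ) ^ 2 / 2) := by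
      rw [← Real.exp_add]
      ring_nf
    have h2 := Real.add_one_le_exp ((m : ℝ) - 1 / 2)
    have h3 := Real.exp_pos (-(m : ℝ) ^ 2 / 2)
    push_cast
    rw [add_sub_cancel_right]
    nlinarith

/-- If the counts of large means are small below `m`, truncation of the means at `m` is cheap
relative to the risk of every soft threshold estimator. -/
lemma sum_min_sq_le {n : ℕ} (θ : Fin n → ℝ) {D l : ℝ} (hD : 0 ≤ D) (hl : 0 ≤ l) {m : ℕ}
    (h : ∀ j : ℕ, 1 ≤ j → j < m → ((Finset.univ.filter fun i => (j : ℝ) ≤ |θ i|).card : ℝ) ≤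
      D * n * Real.exp (-(j : ℝ) ^ 2 / 2)) :
    ∑ i, min (θ i ^ 2) ((m : ℝ) ^ 2) ≤
      (1024 * Real.exp 6 + 72 * D * Real.exp 5) * ∑ i, softRisk (θ i) l := by
  -- Up to `m₀` truncation costs a multiple of `l ^ 2 + 1`. Beyond it the counts decide, and `m₀ - 1
  -- ≥ l + 2` makes their Gaussian sum comparable to the null risk at `l`.
  set m₀ := ⌈l⌉₊ + 3 with hm₀
  have hc1 : l ≤ ⌈l⌉₊ := Nat.le_ceil l
  have hc2 : (⌈l⌉₊ : ℝ) < l + 1 := Nat.ceil_lt_add_one hl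
  have hR : 0 ≤ ∑ i, softRisk (θ i) l := Finset.sum_nonneg fun i _ => softRisk_nonneg _ _
  have hsmall : ∑ i, min (θ i ^ 2) ((m₀ : ℝ) ^ 2) ≤
      1024 * Real.exp 6 * ∑ i, softRisk (θ i) l := by
    rw [Finset.mul_sum]
    refine Finset.sum_le_sum fun i _ => ?_
    have h1 := min_sq_add_one_le_softRisk hl (θ i)
    have h2 : (m₀ : ℝ) ^ 2 ≤ 32 * (l ^ 2 + 1) := by
      rw [hm₀]
      push_cast
      nlinarith [sq_nonneg (l - 4)]
    have h3 : min (θ i ^ 2) ((m₀ : ℝ) ^ 2) ≤ 32 * min (θ i ^ 2) (l ^ 2 + 1) := by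
      rcases min_cases (θ i ^ 2) (l ^ 2 + 1) with h4 | h4 <;> rw [h4.1]
      · linarith [min_le_left (θ i ^ 2) ((m₀ : ℝ) ^ 2), sq_nonneg (θ i)]
      · exact (min_le_right _ _).trans h2
    linarith
  rcases le_total m m₀ with hm | hm
  · have h1 : ∑ i, min (θ i ^ 2) ((m : ℝ) ^ 2) ≤ ∑ i, min (θ i ^ 2) ((m₀ : ℝ) ^ 2) := by
      refine Finset.sum_le_sum fun i _ => min_le_min_left _ ?_
      gcongr
    have : 0 ≤ 72 * D * Real.exp 5 * ∑ i, softRisk (θ i) l := by positivity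
    linarith
  · have h1 := Finset.sum_le_sum fun i (_ : i ∈ Finset.univ) => min_sq_le_add_sum (θ i) hm
    rw [Finset.sum_add_distrib, Finset.sum_comm] at h1
    have h2 : ∑ j ∈ Finset.Ico m₀ m, ∑ i, (if (j : ℝ) ≤ |θ i| then 2 * (j : ℝ) + 1 else 0) ≤
        ∑ j ∈ Finset.Ico m₀ m, D * n * ((2 * (j : ℝ) + 1) * Real.exp (-(j : ℝ) ^ 2 / 2)) := by
      refine Finset.sum_le_sum fun j hj => ?_
      rw [Finset.mem_Ico] at hj
      rw [← Finset.sum_filter, Finset.sum_const, nsmul_eq_mul]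
      have := mul_le_mul_of_nonneg_right (h j (by omega) hj.2)
        (by positivity : (0 : ℝ) ≤ 2 * j + 1)
      linarith
    rw [← Finset.mul_sum] at h2
    have h3 := sum_mul_exp_neg_sq_le (by omega : 1 ≤ m₀) hm
    have h4 : Real.exp (-((m₀ : ℝ) - 1) ^ 2 / 2) ≤ 6 * Real.exp 5 * softRisk 0 l := by
      refine le_trans (Real.exp_le_exp.2 ?_) (exp_neg_add_two_sq_le hl)
      rw [hm₀]
      push_cast
      nlinarith
    have h5 : n * softRisk 0 l ≤ 2 * ∑ i, softRisk (θ i) l := by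
      have := Finset.sum_le_sum fun i (_ : i ∈ Finset.univ) => softRisk_zero_le_two_mul hl (θ i)
      rw [← Finset.mul_sum] at this
      simpa using this
    have h6 : D * n * ∑ j ∈ Finset.Ico m₀ m, (2 * (j : ℝ) + 1) * Real.exp (-(j : ℝ) ^ 2 / 2) ≤
        72 * D * Real.exp 5 * ∑ i, softRisk (θ i) l := by
      calc _ ≤ D * n * (6 * (6 * Real.exp 5 * softRisk 0 l)) := by
            refine mul_le_mul_of_nonneg_left ?_ (by positivity)
            linarith [Real.exp_pos (-((m : ℝ) - 1) ^ 2 / 2)]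
        _ = 36 * D * Real.exp 5 * (n * softRisk 0 l) := by ring
        _ ≤ 36 * D * Real.exp 5 * (2 * ∑ i, softRisk (θ i) l) := by gcongr
        _ = _ := by ring
    linarith

end Bias

/-! ### Null risk at the inflated lower level against `L₂`. -/

section Level

lemma log_nat_ge_half {n : ℕ} (hn : 2 ≤ n) : 1 / 2 ≤ Real.log n := by
  have h1 : Real.log 2 ≤ Real.log n := Real.log_le_log (by norm_num) (by exact_mod_cast hn)
  linarith [Real.log_two_gt_d9]

lemma one_add_xi_sq_le {α a : ℝ} (ha : 0 < a) (haα : a ≤ α) (hα1 : α < 1) {n k : ℕ} (hn : 2 ≤ n)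
    (hk : 1 ≤ k) (hkn : k ≤ n) :
    (1 + xi α n k) ^ 2 ≤ (8 + 8 * Real.log (1 / a)) * Real.log n := by
  have hα : 0 < α := ha.trans_le haα
  have hpos := xi_pos hα hα1 hk hkn
  set ξ := xi α n k with hξ
  have hn' : (0 : ℝ) < n := by positivity
  have hk' : (1 : ℝ) ≤ k := by exact_mod_cast hk
  have h1 := Phi_neg_le hpos.le
  rw [hξ, Phi_neg_xi hα hα1 (by omega) hk (by omega), ← hξ] at h1
  have h2 : a / n ≤ Real.exp (-ξ ^ 2 / 2) := by
    have h3 : a / n ≤ α * k / n := by gcongr; nlinarith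
    have h4 : α * k / (2 * n) = α * k / n / 2 := by field_simp
    linarith
  have h5 := Real.log_le_log (by positivity) h2
  rw [Real.log_exp, Real.log_div ha.ne' hn'.ne'] at h5
  have h6 := log_nat_ge_half hn
  have h7 : 0 ≤ Real.log (1 / a) := Real.log_nonneg (by rw [le_div_iff₀ ha]; linarith)
  rw [one_div, Real.log_inv] at h7 ⊢
  nlinarith [sq_nonneg (ξ - 1)]

/-- `ξ_k` can be far below `√(log n)` when `k` is large; the factor `k` pays for this, and is later
absorbed by the weights `exp (-c k)`. -/
lemma log_le_mul_one_add_xi_sq {α : ℝ} (hα : 0 < α) (hα1 : α < 1) {n k : ℕ}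
    (hk : 1 ≤ k) (hkn : k ≤ n) : Real.log n ≤ 3 * k * (1 + xi α n k ^ 2) := by
  have hpos := xi_pos hα hα1 hk hkn
  set ξ := xi α n k with hξ
  have hk' : (1 : ℝ) ≤ k := by exact_mod_cast hk
  have hn' : (0 : ℝ) < n := by exact_mod_cast hk.trans hkn
  have h1 := le_Phi_neg hpos.le
  rw [hξ, Phi_neg_xi hα hα1 (by omega) hk (by omega), ← hξ, div_le_div_iff₀ (by norm_num)
    (by positivity)] at h1
  have h2 : (n : ℝ) ≤ 3 / 2 * k * Real.exp ((ξ + 1) ^ 2 / 2) := by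
    have h3 : Real.exp (-(ξ + 1) ^ 2 / 2) * Real.exp ((ξ + 1) ^ 2 / 2) = 1 := by
      rw [← Real.exp_add, ← Real.exp_zero]
      ring_nf
    have h4 : Real.exp (-(ξ + 1) ^ 2 / 2) * n ≤ 3 / 2 * k := by nlinarith
    calc (n : ℝ) = Real.exp (-(ξ + 1) ^ 2 / 2) * n * Real.exp ((ξ + 1) ^ 2 / 2) := by
          rw [mul_right_comm, h3, one_mul]
      _ ≤ _ := by gcongr
  have h5 := Real.log_le_log hn' h2
  rw [Real.log_mul (by positivity) (by positivity), Real.log_exp] at h5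
  have h6 := Real.log_le_sub_one_of_pos (by positivity : (0 : ℝ) < 3 / 2 * k)
  nlinarith [sq_nonneg (ξ - 1), sq_nonneg ξ]

lemma rpow_le_rpow_abs_mul {a b Q c : ℝ} (ha : 0 < a) (hb : 0 < b) (hQ : 1 ≤ Q) (hab : a ≤ Q * b)
    (hba : b ≤ Q * a) : a ^ c ≤ Q ^ |c| * b ^ c := by
  have hQ0 : 0 < Q := by linarith
  rcases le_total 0 c with hc | hc
  · rw [abs_of_nonneg hc, ← Real.mul_rpow hQ0.le hb.le]
    exact Real.rpow_le_rpow ha.le hab hc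
  · have h1 : (Q * a) ^ c ≤ b ^ c := Real.rpow_le_rpow_of_nonpos hb hba hc
    rw [abs_of_nonpos hc, Real.rpow_neg hQ0.le]
    rw [Real.mul_rpow hQ0.le ha.le] at h1
    have h2 : 0 < Q ^ c := Real.rpow_pos_of_pos hQ0 c
    rw [inv_mul_eq_div, le_div_iff₀ h2]
    linarith

lemma log_rpow_le {α : ℝ} (hα : 0 < α) (hα1 : α < 1) {n k : ℕ} (hn : 2 ≤ n)
    (hk : 1 ≤ k) (hkn : k ≤ n) {c : ℝ} (hc : 0 < c) (hc2 : c ≤ 2) :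
    Real.log n ^ (c / 2) ≤ 3 * k * (xi α n k ^ c + 2) := by
  have hpos := xi_pos hα hα1 hk hkn
  have hl := log_le_mul_one_add_xi_sq hα hα1 hk hkn
  set ξ := xi α n k with hξ
  have hk' : (1 : ℝ) ≤ k := by exact_mod_cast hk
  have h6 := log_nat_ge_half hn
  calc Real.log n ^ (c / 2) ≤ (3 * k * (1 + ξ ^ 2)) ^ (c / 2) :=
        Real.rpow_le_rpow (by linarith) hl (by linarith)
    _ = (3 * k) ^ (c / 2) * (1 + ξ ^ 2) ^ (c / 2) :=
        Real.mul_rpow (by positivity) (by positivity)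
    _ ≤ (3 * k) ^ (1 : ℝ) * (1 ^ (c / 2) + (ξ ^ 2) ^ (c / 2)) := by
        refine mul_le_mul ?_ ?_ (by positivity) (by positivity)
        · exact Real.rpow_le_rpow_of_exponent_le (by linarith) (by linarith)
        · exact Real.rpow_add_le_add_rpow zero_le_one (sq_nonneg ξ) (by linarith) (by linarith)
    _ = 3 * k * (1 + ξ ^ c) := by
        rw [Real.rpow_one, Real.one_rpow, ← Real.rpow_natCast ξ 2, ← Real.rpow_mul hpos.le]
        congr 3
        push_cast
        ring
    _ ≤ _ := by
        refine mul_le_mul_of_nonneg_left ?_ (by positivity)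
        linarith

/-- Both directions are needed because the exponent `c₂` of these factors may have either sign. -/
lemma logPlus_comparison {α a : ℝ} (ha : 0 < a) (haα : a ≤ α) (hα1 : α < 1) {n k : ℕ}
    (hn : 2 ≤ n) (hk : 1 ≤ k) (hkn : k ≤ n) :
    logPlus (Real.log n) ≤ 6 * k * (1 + Real.log (8 + 8 * Real.log (1 / a))) *
        max 1 (Real.log (xi α n k)) ∧
      max 1 (Real.log (xi α n k)) ≤ 6 * k * (1 + Real.log (8 + 8 * Real.log (1 / a))) *
        logPlus (Real.log n) := by
  have hα : 0 < α := ha.trans_le haα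
  have hpos := xi_pos hα hα1 hk hkn
  have hl := log_le_mul_one_add_xi_sq hα hα1 hk hkn
  have hu := one_add_xi_sq_le ha haα hα1 hn hk hkn
  have hL := log_nat_ge_half hn
  have h7 : 0 ≤ Real.log (1 / a) := Real.log_nonneg (by rw [le_div_iff₀ ha]; linarith)
  set C := 8 + 8 * Real.log (1 / a) with hC
  have hC1 : 0 ≤ Real.log C := Real.log_nonneg (by linarith)
  set ξ := xi α n k with hξ
  have hk' : (1 : ℝ) ≤ k := by exact_mod_cast hk
  have hv1 : 1 ≤ max 1 (Real.log ξ) := le_max_left _ _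
  have hv2 : Real.log ξ ≤ max 1 (Real.log ξ) := le_max_right _ _
  have hp1 : 1 ≤ logPlus (Real.log n) := le_max_left _ _
  have hp2 : Real.log (Real.log n) ≤ logPlus (Real.log n) := le_max_right _ _
  set v := max 1 (Real.log ξ) with hv
  constructor
  · have hkey : logPlus (Real.log n) ≤ 6 * k * v := by
      refine max_le (by nlinarith) ?_
      have h1 := Real.log_le_log (by linarith) hl
      rw [Real.log_mul (by positivity) (by positivity)] at h1
      have h2 := Real.log_le_sub_one_of_pos (by positivity : (0 : ℝ) < 3 * k)
      have h3 : Real.log (1 + ξ ^ 2) ≤ 3 * v := by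
        rcases le_total ξ 1 with h | h
        · have h4 := Real.log_le_sub_one_of_pos (by positivity : (0 : ℝ) < 1 + ξ ^ 2)
          nlinarith
        · have h4 : 1 + ξ ^ 2 ≤ 2 * ξ ^ 2 := by nlinarith
          have h5 := Real.log_le_log (by positivity) h4
          rw [Real.log_mul (by norm_num) (by positivity), Real.log_pow] at h5
          have h6 := Real.log_two_lt_d9
          push_cast at h5
          linarith
      nlinarith
    refine hkey.trans ?_
    refine mul_le_mul_of_nonneg_right ?_ (by linarith)
    exact le_mul_of_one_le_right (by positivity) (by linarith)
  · have hkey : v ≤ (1 + Real.log C) * logPlus (Real.log n) := by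
      refine max_le (by nlinarith) ?_
      have h1 : ξ ^ 2 ≤ C * Real.log n := le_trans (by nlinarith) hu
      have h2 := Real.log_le_log (by positivity) h1
      rw [Real.log_pow, Real.log_mul (by linarith) (by linarith)] at h2
      push_cast at h2
      nlinarith
    refine hkey.trans ?_
    refine mul_le_mul_of_nonneg_right ?_ (by linarith)
    exact le_mul_of_one_le_left (by linarith) (by linarith)

/-- Only the second summand of `L₂` is kept, and one spare power of `logPlus (Real.log n)` in it is
given up. -/
lemma le_L₂ {δ c₁ c₂ : ℝ} (hδ : 0 ≤ δ) {n : ℕ} (hn : 2 ≤ n) :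
    Real.log n ^ (3 * δ / 2) * (Real.log n ^ (-(c₁ / 2)) * logPlus (Real.log n) ^ (-c₂)) ^ (1 + δ) ≤
      L₂ δ c₁ c₂ n := by
  have hL : 0 < Real.log n := by linarith [log_nat_ge_half hn]
  have hp1 : 1 ≤ logPlus (Real.log n) := le_max_left _ _
  have hp0 : 0 < logPlus (Real.log n) := by linarith
  unfold L₂
  set ℓ := Real.log n with hℓ
  set p := logPlus ℓ with hp
  have h1 : ℓ ^ (3 * δ / 2) * (ℓ ^ (-(c₁ / 2)) * p ^ (-c₂)) ^ (1 + δ) =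
      ℓ ^ (-(3 / 2) : ℝ) * (ℓ ^ ((3 - c₁) / 2) * p ^ (-c₂)) ^ (1 + δ) := by
    have h2 : ℓ ^ ((3 - c₁) / 2) = ℓ ^ (3 / 2 : ℝ) * ℓ ^ (-(c₁ / 2)) := by
      rw [← Real.rpow_add hL]
      ring_nf
    have h3 : (ℓ ^ (3 / 2 : ℝ) * (ℓ ^ (-(c₁ / 2)) * p ^ (-c₂))) ^ (1 + δ) =
        ℓ ^ (3 / 2 * (1 + δ)) * (ℓ ^ (-(c₁ / 2)) * p ^ (-c₂)) ^ (1 + δ) := by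
      rw [Real.mul_rpow (by positivity) (by positivity), ← Real.rpow_mul hL.le]
    rw [h2, mul_assoc, h3, ← mul_assoc, ← Real.rpow_add hL]
    ring_nf
  rw [h1]
  refine mul_le_mul_of_nonneg_left (Real.rpow_le_rpow (by positivity) ?_ (by linarith))
    (by positivity)
  have h3 : p ^ (-c₂) ≤ (p ^ (c₂ - 1))⁻¹ := by
    rw [← Real.rpow_neg hp0.le]
    exact Real.rpow_le_rpow_of_exponent_le hp1 (by linarith)
  calc ℓ ^ ((3 - c₁) / 2) * p ^ (-c₂) ≤ ℓ ^ ((3 - c₁) / 2) * (p ^ (c₂ - 1))⁻¹ := by gcongr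
    _ = ℓ ^ ((3 - c₁) / 2) / p ^ (c₂ - 1) := (div_eq_mul_inv _ _).symm
    _ ≤ _ := le_add_of_nonneg_left (by positivity)

lemma mul_mul_div_rearrange {x : ℝ} (hx : x ≠ 0) (E c l b k h d : ℝ) :
    x * (E * (c * l) * (b * k * h / (x * d))) = E * c * b * k * (l * h / d) := by
  simp only [div_eq_mul_inv, mul_inv]
  linear_combination (E * c * l * b * k * h * d⁻¹) * mul_inv_cancel₀ hx

/-- The null risk at the inflated level `√(1 + δ) g(ξ_k)` is controlled by `L₂ / n ^ δ`, up to a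
power of `k`. -/
lemma exists_null_risk_le {a A M₀ : ℝ} (ha : 0 < a) (hM₀ : 0 ≤ M₀) :
    ∃ (C : ℝ) (p : ℕ), 0 ≤ C ∧ ∀ (α δ c₁ c₂ : ℝ) (g : ℝ → ℝ), a ≤ α → α < 1 → 0 ≤ δ → δ ≤ A →
      IsLowerLevel M₀ c₁ c₂ g → ∀ n k : ℕ, 2 ≤ n → 1 ≤ k → k ≤ n →
      n * softRisk 0 (√(1 + δ) * g (xi α n k)) ≤
        C * (k : ℝ) ^ p * (L₂ δ c₁ c₂ n / (n : ℝ) ^ δ) := by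
  by_cases ha1 : 1 ≤ a
  · exact ⟨0, 0, le_rfl, fun α δ c₁ c₂ g h1 h2 => by linarith⟩
  push Not at ha1
  set C₁ := 8 + 8 * Real.log (1 / a) with hC₁
  have h7 : 0 ≤ Real.log (1 / a) := Real.log_nonneg (by rw [le_div_iff₀ ha]; linarith)
  have hC₁1 : 1 ≤ C₁ := by linarith
  set q := 6 * (1 + Real.log C₁) with hq
  have hq1 : 1 ≤ q := by linarith [Real.log_nonneg hC₁1]
  set b := 3 * (M₀ + 1) * q ^ M₀ with hb
  have hb1 : 1 ≤ b := by
    have := Real.one_le_rpow hq1 hM₀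
    nlinarith
  refine ⟨4 * Real.exp (5 * (1 + A)) * C₁ ^ (3 * A / 2) * b ^ (1 + A), ⌈(2 + M₀) * (1 + A)⌉₊,
    by positivity, ?_⟩
  intro α δ c₁ c₂ g haα hα1 hδ hδA hg n k hn hk hkn
  have hα : 0 < α := ha.trans_le haα
  have hpos := xi_pos hα hα1 hk hkn
  have hu := one_add_xi_sq_le ha haα hα1 hn hk hkn
  have hcmp := logPlus_comparison ha haα hα1 hn hk hkn
  have hlog := log_rpow_le hα hα1 hn hk hkn hg.c₁_pos hg.c₁_le
  have hPhi := Phi_neg_xi hα hα1 (by omega : 1 ≤ n) hk (by omega : k ≤ n + 1)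
  have hr := (hg.risk_le _ hpos).trans (min_le_right _ _)
  have hgb := hg.bounds _ hpos
  rw [hPhi] at hr
  rw [← hC₁] at hu hcmp
  clear_value C₁ q b
  set ξ := xi α n k with hξ
  have hk' : (1 : ℝ) ≤ k := by exact_mod_cast hk
  have hn' : (0 : ℝ) < n := by positivity
  have hL : 0 < Real.log n := by linarith [log_nat_ge_half hn]
  have hp0 : 0 < logPlus (Real.log n) := lt_of_lt_of_le one_pos (le_max_left _ _)
  have hv0 : 0 < max 1 (Real.log ξ) := lt_of_lt_of_le one_pos (le_max_left _ _)
  set ℓ := Real.log n with hℓ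
  set lp := logPlus ℓ with hlp
  set v := max 1 (Real.log ξ) with hv
  clear_value v lp ℓ ξ
  have hQ : 6 * (k : ℝ) * (1 + Real.log C₁) = q * k := by rw [hq]; ring
  rw [hQ] at hcmp
  have hQ1 : 1 ≤ q * k := by nlinarith
  have hvc : lp ^ c₂ ≤ (q * k) ^ M₀ * v ^ c₂ := by
    refine (rpow_le_rpow_abs_mul hp0 hv0 hQ1 hcmp.1 hcmp.2).trans ?_
    have := Real.rpow_le_rpow_of_exponent_le hQ1 hg.abs_c₂_le
    gcongr
  set H := ℓ ^ (-(c₁ / 2)) * lp ^ (-c₂) with hH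
  have hH0 : 0 < H := by positivity
  clear_value H
  -- One `k` comes from `Φ(-ξ_k)`, one from comparing `ξ_k ^ c₁` with `log n`, and `k ^ M₀` from the
  -- iterated logarithm.
  have hr2 : softRisk 0 (g ξ) ≤ b * (k : ℝ) ^ (2 + M₀) * H / n := by
    refine hr.trans ?_
    have hden : ℓ ^ (c₁ / 2) * lp ^ c₂ ≤ 3 * k * (q * k) ^ M₀ * ((ξ ^ c₁ + 2) * v ^ c₂) := by
      calc _ ≤ 3 * k * (ξ ^ c₁ + 2) * ((q * k) ^ M₀ * v ^ c₂) := by gcongr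
        _ = _ := by ring
    have hHinv : H * (ℓ ^ (c₁ / 2) * lp ^ c₂) = 1 := by
      rw [hH, Real.rpow_neg hL.le, Real.rpow_neg hp0.le]
      field_simp
    have hkp : (k : ℝ) ^ (2 + M₀) = k * k * (k : ℝ) ^ M₀ := by
      rw [Real.rpow_add (by linarith), Real.rpow_two, sq]
    have hD0 : 0 < (ξ ^ c₁ + 2) * v ^ c₂ := by positivity
    rw [div_le_div_iff₀ hD0 hn']
    calc M₀ * (α * k / (2 * n)) * n = M₀ * α / 2 * k := by field_simp
      _ ≤ (M₀ + 1) * k := by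
          refine mul_le_mul_of_nonneg_right ?_ (by linarith)
          nlinarith
      _ = (M₀ + 1) * k * (H * (ℓ ^ (c₁ / 2) * lp ^ c₂)) := by rw [hHinv, mul_one]
      _ ≤ (M₀ + 1) * k * (H * (3 * k * (q * k) ^ M₀ * ((ξ ^ c₁ + 2) * v ^ c₂))) := by gcongr
      _ = b * (k : ℝ) ^ (2 + M₀) * H * ((ξ ^ c₁ + 2) * v ^ c₂) := by
          rw [hb, hkp, Real.mul_rpow (by linarith) (by linarith)]
          ring
  have hg1 : (1 + g ξ) ^ (3 * δ) ≤ C₁ ^ (3 * A / 2) * ℓ ^ (3 * δ / 2) := by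
    calc (1 + g ξ) ^ (3 * δ) ≤ (1 + ξ) ^ (3 * δ) :=
          Real.rpow_le_rpow (by linarith) (by linarith) (by linarith)
      _ = ((1 + ξ) ^ 2) ^ (3 * δ / 2) := by
          rw [← Real.rpow_natCast (1 + ξ) 2, ← Real.rpow_mul (by linarith)]
          congr 1
          push_cast
          ring
      _ ≤ (C₁ * ℓ) ^ (3 * δ / 2) := Real.rpow_le_rpow (sq_nonneg _) hu (by linarith)
      _ = C₁ ^ (3 * δ / 2) * ℓ ^ (3 * δ / 2) := Real.mul_rpow (by linarith) hL.le
      _ ≤ _ := by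
          refine mul_le_mul_of_nonneg_right ?_ (by positivity)
          exact Real.rpow_le_rpow_of_exponent_le hC₁1 (by linarith)
  have hbk : 1 ≤ b * (k : ℝ) ^ (2 + M₀) :=
    one_le_mul_of_one_le_of_one_le hb1 (Real.one_le_rpow hk' (by linarith))
  -- The power `1 + δ` turns `1 / n` into `1 / n ^ (1 + δ)`; after summing `n` coordinates `n ^
  -- (-δ)` remains.
  have hr3 : softRisk 0 (g ξ) ^ (1 + δ) ≤
      b ^ (1 + A) * (k : ℝ) ^ ⌈(2 + M₀) * (1 + A)⌉₊ * H ^ (1 + δ) / (n * (n : ℝ) ^ δ) := by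
    calc _ ≤ (b * (k : ℝ) ^ (2 + M₀) * H / n) ^ (1 + δ) :=
          Real.rpow_le_rpow (softRisk_nonneg _ _) hr2 (by linarith)
      _ = (b * (k : ℝ) ^ (2 + M₀)) ^ (1 + δ) * H ^ (1 + δ) / (n * (n : ℝ) ^ δ) := by
          rw [Real.div_rpow (by positivity) hn'.le, Real.mul_rpow (by positivity) hH0.le,
            Real.rpow_add hn', Real.rpow_one]
      _ ≤ (b * (k : ℝ) ^ (2 + M₀)) ^ (1 + A) * H ^ (1 + δ) / (n * (n : ℝ) ^ δ) := by
          have := Real.rpow_le_rpow_of_exponent_le hbk (by linarith : 1 + δ ≤ 1 + A)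
          gcongr
      _ ≤ _ := by
          rw [Real.mul_rpow (by positivity) (by positivity), ← Real.rpow_mul (by linarith)]
          have : (k : ℝ) ^ ((2 + M₀) * (1 + A)) ≤ (k : ℝ) ^ ⌈(2 + M₀) * (1 + A)⌉₊ := by
            rw [← Real.rpow_natCast]
            exact Real.rpow_le_rpow_of_exponent_le hk' (Nat.le_ceil _)
          gcongr
  have hexp : Real.exp (5 * (1 + δ)) ≤ Real.exp (5 * (1 + A)) := Real.exp_le_exp.2 (by linarith)
  calc n * softRisk 0 (√(1 + δ) * g ξ)
      ≤ n * (4 * Real.exp (5 * (1 + δ)) * (1 + g ξ) ^ (3 * δ) * softRisk 0 (g ξ) ^ (1 + δ)) :=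
        mul_le_mul_of_nonneg_left (softRisk_zero_sqrt_mul_le hgb.1 hδ) hn'.le
    _ ≤ n * (4 * Real.exp (5 * (1 + A)) * (C₁ ^ (3 * A / 2) * ℓ ^ (3 * δ / 2)) *
          (b ^ (1 + A) * (k : ℝ) ^ ⌈(2 + M₀) * (1 + A)⌉₊ * H ^ (1 + δ) / (n * (n : ℝ) ^ δ))) := by
        have h1 : 0 ≤ (1 + g ξ) ^ (3 * δ) := Real.rpow_nonneg (by linarith) _
        have h2 : 0 ≤ softRisk 0 (g ξ) ^ (1 + δ) := Real.rpow_nonneg (softRisk_nonneg _ _) _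
        refine mul_le_mul_of_nonneg_left ?_ hn'.le
        refine mul_le_mul (mul_le_mul (by linarith) hg1 h1 (by positivity)) hr3 h2 (by positivity)
    _ = 4 * Real.exp (5 * (1 + A)) * C₁ ^ (3 * A / 2) * b ^ (1 + A) *
          (k : ℝ) ^ ⌈(2 + M₀) * (1 + A)⌉₊ * (ℓ ^ (3 * δ / 2) * H ^ (1 + δ) / (n : ℝ) ^ δ) :=
        mul_mul_div_rearrange hn'.ne' _ _ _ _ _ _ _
    _ ≤ _ := by
        have := le_L₂ (c₁ := c₁) (c₂ := c₂) hδ hn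
        rw [← hℓ, ← hlp, ← hH] at this
        refine mul_le_mul_of_nonneg_left ?_ (by positivity)
        exact div_le_div_of_nonneg_right this (by positivity)

end Level

/-! ### Total surviving noise and the cost of large means. -/

section Oracle

variable {n : ℕ} {θ : Fin n → ℝ} {Ω : Type*} [MeasurableSpace Ω] {P : Measure Ω}
  {X : Fin n → Ω → ℝ}

lemma exists_sum_pow_mul_exp_le (p : ℕ) {c : ℝ} (hc : 0 < c) :
    ∃ S : ℝ, 0 ≤ S ∧ ∀ T : Finset ℕ, ∑ k ∈ T, (k : ℝ) ^ p * Real.exp (-c * k) ≤ S := by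
  have h := Real.summable_pow_mul_exp_neg_nat_mul p hc
  have h0 : ∀ k : ℕ, 0 ≤ (k : ℝ) ^ p * Real.exp (-c * k) := fun k => by positivity
  exact ⟨_, tsum_nonneg h0, fun T => h.sum_le_tsum T fun k _ => h0 k⟩

lemma one_le_sqrt_one_add {δ : ℝ} (hδ : 0 ≤ δ) : 1 ≤ √(1 + δ) := Real.one_le_sqrt.2 (by linarith)

lemma IsLowerLevel.monotoneOn {M₀ c₁ c₂ : ℝ} {g : ℝ → ℝ} (hg : IsLowerLevel M₀ c₁ c₂ g) :
    MonotoneOn g (Set.Ioi 0) := by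
  refine monotoneOn_of_deriv_nonneg (convex_Ioi 0)
    (fun x hx => (hg.differentiable x hx).continuousAt.continuousWithinAt) ?_ ?_
  · rw [interior_Ioi]
    exact fun x hx => (hg.differentiable x hx).differentiableWithinAt
  · rw [interior_Ioi]
    exact fun x hx => (hg.deriv_bounds x hx).1

lemma IsLowerLevel.mul_softRisk_le {M₀ c₁ c₂ : ℝ} {g : ℝ → ℝ} (hg : IsLowerLevel M₀ c₁ c₂ g)
    {α : ℝ} (hα : 0 < α) (hα1 : α < 1) {k : ℕ} (hk : 1 ≤ k) (hkn : k ≤ n) :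
    n * softRisk 0 (g (xi α n k)) ≤ 2 * k := by
  have hn : (0 : ℝ) < n := by exact_mod_cast hk.trans hkn
  have hk' : (1 : ℝ) ≤ k := by exact_mod_cast hk
  have h := (hg.risk_le _ (xi_pos hα hα1 hk hkn)).trans (min_le_left _ _)
  rw [Phi_neg_xi hα hα1 (hk.trans hkn) hk (by omega)] at h
  calc n * softRisk 0 (g (xi α n k)) ≤ n * (4 * (α * k / (2 * n))) := by gcongr
    _ = 2 * (α * k) := by field_simp; ring
    _ ≤ 2 * k := by nlinarith

/-- The total noise surviving the lower threshold level is of the order of `∑ min(θ_i², 1)`. -/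
lemma exists_total_noise_bound {a α' A M₀ : ℝ} (ha : 0 < a) (haα' : a < α') (hα' : α' < 1)
    (hM₀ : 0 ≤ M₀) :
    ∃ C : ℝ, 0 ≤ C ∧ ∀ (α δ c₁ c₂ : ℝ) (g : ℝ → ℝ), a ≤ α → α ≤ α' → 0 ≤ δ → δ ≤ A →
      IsLowerLevel M₀ c₁ c₂ g → ∀ (n : ℕ), 2 ≤ n → ∀ (θ : Fin n → ℝ),
      L₂ δ c₁ c₂ n / (n : ℝ) ^ δ ≤ ∑ i, θ i ^ 2 →
      ∀ (Ω : Type*) [MeasurableSpace Ω] (P : Measure Ω) (X : Fin n → Ω → ℝ),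
      iIndepFun X P → (∀ i, HasLaw (X i) (gaussianReal (θ i) 1) P) →
      ∃ Y : Fin n → Ω → ℝ, (∀ i, Integrable (Y i) P) ∧
        (∀ i ω l, √(1 + δ) * g (xiHat₁ α fun j => X j ω) ≤ l →
          max (|X i ω - θ i| - l) 0 ^ 2 ≤ Y i ω) ∧
        ∑ i, ∫ ω, Y i ω ∂P ≤ C * ∑ i, min (θ i ^ 2) 1 := by
  obtain ⟨t, c, ht, ht1, hc, htc⟩ := exists_tilt (ha.trans haα') hα'
  obtain ⟨C, p, hC, hrisk⟩ := exists_null_risk_le (A := A) ha hM₀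
  obtain ⟨S, hS, hsum⟩ := exists_sum_pow_mul_exp_le p hc
  obtain ⟨S₁, hS₁, hsum₁⟩ := exists_sum_pow_mul_exp_le 1 (half_pos hc)
  refine ⟨C * Real.exp 3 * S + (8 / c + 2 + 2 * Real.exp 1 * S₁), by positivity, ?_⟩
  intro α δ c₁ c₂ g haα hαα' hδ hδA hg n hn θ hθ Ω _ P X hX hlaw
  have hα : 0 < α := ha.trans_le haα
  have hα1 : α < 1 := hαα'.trans_lt hα'
  set B := ∑ i, min (θ i ^ 2) 1 with hB
  have hB0 : 0 ≤ B := Finset.sum_nonneg fun i _ => le_min (sq_nonneg _) zero_le_one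
  have hs1 := one_le_sqrt_one_add hδ
  rcases lt_or_ge B 1 with hB1 | hB1
  · choose Y hY1 hY2 hY3 using fun i => exists_noise_bound hX hlaw hα hαα' hα' ht ht1 htc
      (G := fun x => √(1 + δ) * g x) (fun x hx => mul_nonneg (by linarith) (hg.bounds x hx).1)
      (K := 0) (Or.inl rfl) i
    refine ⟨Y, hY1, hY2, ?_⟩
    -- With `B < 1` no square is truncated, so the assumed lower bound on `‖θ‖²` is a lower bound on
    -- `B`.
    have hθB : ∑ i, θ i ^ 2 = B := by
      refine Finset.sum_congr rfl fun i _ => (min_eq_left ?_).symm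
      by_contra h
      have h1 : min (θ i ^ 2) 1 ≤ B := Finset.single_le_sum
        (f := fun i => min (θ i ^ 2) 1) (fun i _ => le_min (sq_nonneg _) zero_le_one)
        (Finset.mem_univ i)
      rw [min_eq_right (not_le.1 h).le] at h1
      linarith
    rw [hθB] at hθ
    calc ∑ i, ∫ ω, Y i ω ∂P
        ≤ ∑ i : Fin n, ∑ k ∈ Finset.Ioc 0 n, softRisk 0 (√(1 + δ) * g (xi α n k)) *
            Real.exp (1 + 2 * B - c * k) := Finset.sum_le_sum fun i _ => by
          simpa using hY3 i
      _ = ∑ k ∈ Finset.Ioc 0 n, n * softRisk 0 (√(1 + δ) * g (xi α n k)) *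
            Real.exp (1 + 2 * B - c * k) := by
          rw [Finset.sum_const, Finset.card_univ, Fintype.card_fin, nsmul_eq_mul, Finset.mul_sum]
          exact Finset.sum_congr rfl fun k _ => by ring
      _ ≤ ∑ k ∈ Finset.Ioc 0 n, C * Real.exp 3 * B * ((k : ℝ) ^ p * Real.exp (-c * k)) := by
          refine Finset.sum_le_sum fun k hk => ?_
          rw [Finset.mem_Ioc] at hk
          have h1 := hrisk α δ c₁ c₂ g haα hα1 hδ hδA hg n k hn (by omega) hk.2
          have h2 : Real.exp (1 + 2 * B - c * k) ≤ Real.exp 3 * Real.exp (-c * k) := by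
            rw [← Real.exp_add]
            exact Real.exp_le_exp.2 (by linarith)
          calc _ ≤ C * (k : ℝ) ^ p * B * (Real.exp 3 * Real.exp (-c * k)) := by
                refine mul_le_mul (h1.trans ?_) h2 (Real.exp_pos _).le (by positivity)
                exact mul_le_mul_of_nonneg_left hθ (by positivity)
            _ = _ := by ring
      _ = C * Real.exp 3 * B * ∑ k ∈ Finset.Ioc 0 n, (k : ℝ) ^ p * Real.exp (-c * k) :=
          (Finset.mul_sum _ _ _).symm
      _ ≤ C * Real.exp 3 * B * S := mul_le_mul_of_nonneg_left (hsum _) (by positivity)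
      _ ≤ _ := by
          have : 0 ≤ (8 / c + 2 + 2 * Real.exp 1 * S₁) * B := by positivity
          linarith
  -- For `k > K` one has `2 B - c k ≤ -c k / 2`. Bounding the levels up to `K` by the single level
  -- `ξ_K`, at cost `2 K`, avoids the factor `exp (2 B)`.
  · set K := min ⌈4 * B / c⌉₊ n with hK
    have hK1 : 1 ≤ K := le_min (Nat.ceil_pos.2 (by positivity)) (by omega)
    have hKn : K ≤ n := min_le_right _ _
    choose Y hY1 hY2 hY3 using fun i => exists_noise_bound hX hlaw hα hαα' hα' ht ht1 htc
      (G := g) (fun x hx => (hg.bounds x hx).1) (K := K) (Or.inr ⟨hKn, hg.monotoneOn⟩) i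
    refine ⟨Y, hY1, fun i ω l hl => hY2 i ω l (le_trans ?_ hl), ?_⟩
    · obtain ⟨k, hk1, hkn, e, -⟩ := exists_xiHat₁_eq α (by omega : 1 ≤ n) fun j => X j ω
      rw [e]
      exact le_mul_of_one_le_left (hg.bounds _ (xi_pos hα hα1 hk1 hkn)).1 hs1
    · have hKB : (K : ℝ) ≤ 4 * B / c + 1 := by
        have h1 : (K : ℝ) ≤ ⌈4 * B / c⌉₊ := by exact_mod_cast min_le_left _ _
        have h2 := Nat.ceil_lt_add_one (by positivity : 0 ≤ 4 * B / c)
        linarith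
      calc ∑ i, ∫ ω, Y i ω ∂P
          ≤ ∑ i : Fin n, (softRisk 0 (g (xi α n K)) + ∑ k ∈ Finset.Ioc K n,
              softRisk 0 (g (xi α n k)) * Real.exp (1 + 2 * B - c * k)) :=
            Finset.sum_le_sum fun i _ => by
              have := hY3 i
              rwa [if_neg (by omega)] at this
        _ = n * softRisk 0 (g (xi α n K)) + ∑ k ∈ Finset.Ioc K n, n * softRisk 0 (g (xi α n k)) *
              Real.exp (1 + 2 * B - c * k) := by
            rw [Finset.sum_const, Finset.card_univ, Fintype.card_fin, nsmul_eq_mul, mul_add,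
              Finset.mul_sum]
            congr 1
            exact Finset.sum_congr rfl fun k _ => by ring
        _ ≤ 2 * K + ∑ k ∈ Finset.Ioc K n,
              2 * Real.exp 1 * ((k : ℝ) ^ 1 * Real.exp (-(c / 2) * k)) := by
            refine add_le_add (hg.mul_softRisk_le hα hα1 hK1 hKn)
              (Finset.sum_le_sum fun k hk => ?_)
            rw [Finset.mem_Ioc] at hk
            have h1 := hg.mul_softRisk_le hα hα1 (by omega : 1 ≤ k) hk.2
            have h2 : 4 * B / c ≤ k := by
              refine (Nat.le_ceil _).trans ?_
              exact_mod_cast (by omega : ⌈4 * B / c⌉₊ ≤ k)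
            rw [div_le_iff₀ hc] at h2
            have h3 : Real.exp (1 + 2 * B - c * k) ≤ Real.exp 1 * Real.exp (-(c / 2) * k) := by
              rw [← Real.exp_add]
              exact Real.exp_le_exp.2 (by linarith)
            calc _ ≤ 2 * (k : ℝ) * (Real.exp 1 * Real.exp (-(c / 2) * k)) :=
                  mul_le_mul h1 h3 (Real.exp_pos _).le (by positivity)
              _ = _ := by ring
        _ = 2 * K + 2 * Real.exp 1 *
              ∑ k ∈ Finset.Ioc K n, (k : ℝ) ^ 1 * Real.exp (-(c / 2) * k) := by
            rw [← Finset.mul_sum]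
        _ ≤ 2 * (4 * B / c + 1) + 2 * Real.exp 1 * S₁ := by
            have := mul_le_mul_of_nonneg_left (hsum₁ (Finset.Ioc K n))
              (by positivity : 0 ≤ 2 * Real.exp 1)
            linarith
        _ ≤ 8 / c * B + 2 * B + 2 * Real.exp 1 * S₁ * B := by
            have h1 : 2 * (4 * B / c + 1) = 8 / c * B + 2 := by ring
            have h2 : 0 ≤ 2 * Real.exp 1 * S₁ := by positivity
            nlinarith
        _ ≤ _ := by
            have : 0 ≤ C * Real.exp 3 * S * B := by positivity
            linarith

/-- Splitting of the coordinates into large and small means, with a bound on the step-down level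
for which the large means are cheap relative to every soft threshold estimator. -/
lemma exists_large_means [IsProbabilityMeasure P] (hn : 1 ≤ n) (hX : iIndepFun X P)
    (hlaw : ∀ i, HasLaw (X i) (gaussianReal (θ i) 1) P) {α D : ℝ} (hα : 0 < α) (hα1 : α < 1)
    (hD0 : 0 ≤ D) (hD : 8 ≤ D * α) :
    ∃ (S : Finset (Fin n)) (Y : Ω → ℝ), Integrable Y P ∧
      (∀ ω, xiHat₂ α (fun j => X j ω) ^ 2 ≤ Y ω) ∧
      ∀ l, 0 ≤ l → S.card * ∫ ω, Y ω ∂P + S.card + ∑ i ∈ Sᶜ, θ i ^ 2 ≤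
        15 * (1024 * Real.exp 6 + 72 * D * Real.exp 5) * ∑ i, softRisk (θ i) l := by
  classical
  -- The least such `m` serves twice: enough means reach it to bound the step-down level, and too
  -- few reach any smaller integer for truncation at `m` to be costly.
  by_cases hex : ∃ m : ℕ, 1 ≤ m ∧ D * n * Real.exp (-(m : ℝ) ^ 2 / 2) ≤
      (Finset.univ.filter fun i => (m : ℝ) ≤ |θ i|).card
  · obtain ⟨hm, hF⟩ := Nat.find_spec hex
    have hmin := fun j hj => Nat.find_min hex (m := j) hj
    set m := Nat.find hex
    obtain ⟨Y, hYi, hY, hYE⟩ := exists_xiHat₂_bound hX hlaw hα hα1 hD hn hm hF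
    refine ⟨Finset.univ.filter fun i => (m : ℝ) ≤ |θ i|, Y, hYi, hY, fun l hl => ?_⟩
    set S := Finset.univ.filter fun i => (m : ℝ) ≤ |θ i| with hS
    have hm' : (1 : ℝ) ≤ m := by exact_mod_cast hm
    have h1 := sum_min_sq_le θ hD0 hl (m := m) fun j hj1 hjm => by
      have := hmin j hjm
      push Not at this
      exact (this hj1).le
    have h2 : ∑ i, min (θ i ^ 2) ((m : ℝ) ^ 2) = S.card * (m : ℝ) ^ 2 + ∑ i ∈ Sᶜ, θ i ^ 2 := by
      rw [← Finset.sum_add_sum_compl S]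
      congr 1
      · rw [← nsmul_eq_mul, ← Finset.sum_const]
        refine Finset.sum_congr rfl fun i hi => min_eq_right ?_
        rw [← sq_abs (θ i)]
        exact pow_le_pow_left₀ (by linarith) (Finset.mem_filter.1 hi).2 2
      · refine Finset.sum_congr rfl fun i hi => min_eq_left ?_
        have : ¬ (m : ℝ) ≤ |θ i| := fun h =>
          (Finset.mem_compl.1 hi) (Finset.mem_filter.2 ⟨Finset.mem_univ i, h⟩)
        rw [← sq_abs (θ i)]
        exact pow_le_pow_left₀ (abs_nonneg _) (not_le.1 this).le 2
    have h3 : (S.card : ℝ) * ∫ ω, Y ω ∂P ≤ S.card * (14 * (m : ℝ) ^ 2) := by gcongr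
    have h4 : (S.card : ℝ) ≤ S.card * (m : ℝ) ^ 2 :=
      le_mul_of_one_le_right (by positivity) (by nlinarith)
    have h5 : 0 ≤ ∑ i ∈ Sᶜ, θ i ^ 2 := Finset.sum_nonneg fun _ _ => sq_nonneg _
    linarith
  · push Not at hex
    -- Without such an `m` every mean is treated as small. The bound on the level is then multiplied
    -- by `S.card = 0`, so any constant will do.
    refine ⟨∅, fun _ => ∑ k ∈ Finset.Icc 1 n, xi α n k ^ 2, integrable_const _, fun ω => ?_,
      fun l hl => ?_⟩
    · obtain ⟨k, hk1, hkn, e, -⟩ := exists_xiHat₂_eq α hn fun j => X j ω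
      rw [e]
      exact Finset.single_le_sum (f := fun k => xi α n k ^ 2) (fun _ _ => sq_nonneg _)
        (Finset.mem_Icc.2 ⟨hk1, hkn⟩)
    -- So large that truncation at `m` changes nothing.
    · set m := ⌈∑ i, |θ i|⌉₊ with hm
      have h1 := sum_min_sq_le θ hD0 hl (m := m) fun j hj1 _ => (hex j hj1).le
      have h2 : ∑ i, min (θ i ^ 2) ((m : ℝ) ^ 2) = ∑ i, θ i ^ 2 := by
        refine Finset.sum_congr rfl fun i _ => min_eq_left ?_
        rw [← sq_abs (θ i)]
        refine pow_le_pow_left₀ (abs_nonneg _) ?_ 2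
        exact (Finset.single_le_sum (f := fun i => |θ i|) (fun _ _ => abs_nonneg _)
          (Finset.mem_univ i)).trans (Nat.le_ceil _)
      have h3 : 0 ≤ ∑ i, min (θ i ^ 2) ((m : ℝ) ^ 2) :=
        Finset.sum_nonneg fun _ _ => le_min (sq_nonneg _) (sq_nonneg _)
      simp only [Finset.card_empty, Nat.cast_zero, zero_mul, zero_add, Finset.compl_empty]
      linarith

lemma integral_sqLoss_soft [IsFiniteMeasure P]
    (hlaw : ∀ i, HasLaw (X i) (gaussianReal (θ i) 1) P) {l : ℝ} (hl : 0 ≤ l) :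
    ∫ ω, sqLoss (fun i => soft l (X i ω)) θ ∂P = ∑ i, softRisk (θ i) l := by
  have hcont := continuous_soft hl
  unfold sqLoss
  rw [integral_finsetSum]
  · refine Finset.sum_congr rfl fun i _ => ?_
    rw [integral_comp_of_hasLaw hlaw i (h := fun x => (soft l x - θ i) ^ 2)
      (hcont.sub continuous_const |>.pow 2).measurable]
    have := integral_centered (θ i) fun y => (soft l (y + θ i) - θ i) ^ 2
    simp only [sub_add_cancel] at this
    exact this
  · intro i _
    have hm : Measurable fun x => (soft l x - θ i) ^ 2 :=
      (hcont.sub continuous_const |>.pow 2).measurable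
    refine (((integrable_centered_sq hlaw i).const_mul 2).add
      (integrable_const (2 * l ^ 2))).mono'
      (hm.comp_aemeasurable (hlaw i).aemeasurable).aestronglyMeasurable (ae_of_all _ fun ω => ?_)
    have h := abs_soft_add_sub_le hl (X i ω - θ i) (θ i)
    rw [sub_add_cancel] at h
    rw [Real.norm_of_nonneg (sq_nonneg _), ← sq_abs]
    simp only [Pi.add_apply]
    nlinarith [abs_nonneg (soft l (X i ω) - θ i), sq_abs (X i ω - θ i),
      sq_nonneg (|X i ω - θ i| - l)]

end Oracle

end FDRThreshold

/-! ### The oracle inequality. -/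

open FDRThreshold

theorem corollary3 (α₁' α₂' β₀ A M₀ : ℝ) (hα₂' : 0 < α₂') (hα' : α₂' < α₁') (hα₁' : α₁' < 1)
    (hβ₀ : 0 < β₀) (hβ₀' : β₀ ≤ 1 / 2) (hA : 0 < A) :
    ∃ M : ℝ,
      ∀ (α₁ α₂ κ₀ κ₁ : ℝ), α₂' < α₂ → α₂ ≤ α₁ → α₁ < α₁' → 1 ≤ κ₀ → κ₀ < 2 →
      ∀ (δ₁ δ₂ c₁ c₂ : ℕ → ℝ) (g : ℕ → ℝ → ℝ),
        (∀ n, 1 ≤ n → 0 ≤ δ₁ n ∧ δ₁ n ≤ min (δ₂ n) A) →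
        (∀ n, 1 ≤ n → FDRThreshold.IsLowerLevel M₀ (c₁ n) (c₂ n) (g n)) →
        (∀ n : ℕ, 1 ≤ n → (n : ℕ∞) < FDRThreshold.nStar α₁' β₀ → 1 + δ₂ n ≤ A) →
      ∀ (n : ℕ), 2 ≤ n →
      ∀ (t : ℝ → ℝ → ℝ), FDRThreshold.IsSmoothThreshold κ₀ κ₁ t →
      ∀ (θ : Fin n → ℝ),
        FDRThreshold.L₂ (δ₁ n) (c₁ n) (c₂ n) n / (n : ℝ) ^ (δ₁ n) ≤ ∑ i, θ i ^ 2 →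
      ∀ (Ω : Type*) [MeasurableSpace Ω] (P : Measure Ω) [IsProbabilityMeasure P]
        (X : Fin n → Ω → ℝ) (lam : Ω → ℝ),
        iIndepFun X P →
        (∀ i, HasLaw (X i) (gaussianReal (θ i) 1) P) →
        AEMeasurable lam P →
        (∀ᵐ ω ∂P,
          Real.sqrt (1 + δ₁ n) * g n (FDRThreshold.xiHat₁ α₁ fun i => X i ω) ≤ lam ω ∧
          lam ω ≤ Real.sqrt (1 + δ₂ n) * FDRThreshold.xiHat₂ α₂ fun i => X i ω) →
        Integrable (fun ω => FDRThreshold.sqLoss (fun i => t (lam ω) (X i ω)) θ) P ∧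
        ∫ ω, FDRThreshold.sqLoss (fun i => t (lam ω) (X i ω)) θ ∂P ≤
          M * (1 + δ₂ n) *
            ⨅ l : ℝ≥0, ∫ ω, FDRThreshold.sqLoss (fun i => FDRThreshold.soft l (X i ω)) θ ∂P := by

  by_cases hM₀ : 0 ≤ M₀
  swap
  -- Negative `M₀` is vacuous because `|c₂| ≤ M₀`.
  · refine ⟨0, fun α₁ α₂ κ₀ κ₁ _ _ _ _ _ δ₁ δ₂ c₁ c₂ g _ hg => ?_⟩
    exact absurd ((abs_nonneg _).trans (hg 1 le_rfl).abs_c₂_le) hM₀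
  obtain ⟨C, hC, hnoise⟩ := exists_total_noise_bound (A := A) hα₂' hα' hα₁' hM₀
  set D : ℝ := 8 / α₂' with hD
  set E : ℝ := 15 * (1024 * Real.exp 6 + 72 * D * Real.exp 5) with hE
  have hD0 : 0 ≤ D := by positivity
  have hE0 : 0 ≤ E := by positivity
  -- The first term pays for the noise surviving at small means, the second for the small means
  -- themselves and for the large ones. `D = 8 / α₂'` ensures `D * α₂ ≥ 8`.
  refine ⟨16 * C * (32 * Real.exp 6) + 18 * E, ?_⟩
  intro α₁ α₂ κ₀ κ₁ hα₂ hα₂₁ hα₁ _ hκ₀ δ₁ δ₂ c₁ c₂ g hδ hg _ n hn t ht θ hθ Ω _ P _ X lam hX hlaw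
    hlam hlevel
  obtain ⟨hδ₁, hδ₁'⟩ := hδ n (by omega)
  have hδ₂ : 0 ≤ δ₂ n := hδ₁.trans (hδ₁'.trans (min_le_left _ _))
  have hα₁0 : 0 < α₁ := by linarith
  have hα₁1 : α₁ < 1 := by linarith
  have hgn := hg n (by omega)
  obtain ⟨Y, hYi, hY, hYE⟩ := hnoise α₁ (δ₁ n) (c₁ n) (c₂ n) (g n) (by linarith) hα₁.le hδ₁
    (hδ₁'.trans (min_le_right _ _)) hgn n hn θ hθ Ω P X hX hlaw
  obtain ⟨S, Y₂, hY₂i, hY₂, hSE⟩ := exists_large_means (by omega : 1 ≤ n) hX hlaw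
    (α := α₂) (D := D) (by linarith) (by linarith) hD0 (by
      rw [hD, div_mul_eq_mul_div, le_div_iff₀ hα₂']
      linarith)
  have hlow : ∀ ω, 0 ≤ √(1 + δ₁ n) * g n (xiHat₁ α₁ fun i => X i ω) := by
    intro ω
    obtain ⟨k, hk1, hkn, e, -⟩ := exists_xiHat₁_eq α₁ (by omega : 1 ≤ n) fun i => X i ω
    rw [e]
    exact mul_nonneg (Real.sqrt_nonneg _) (hgn.bounds _ (xi_pos hα₁0 hα₁1 hk1 hkn)).1
  -- An integrable majorant of the loss in which the random level no longer appears: the noise bound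
  -- off `S`, the bound on the step-down level on `S`.
  let Z : Ω → ℝ := fun ω => ∑ i ∈ Sᶜ, (16 * Y i ω + 18 * θ i ^ 2) +
    ∑ i ∈ S, (2 * (1 + δ₂ n) * Y₂ ω + 2 * (X i ω - θ i) ^ 2)
  have hZ1 : ∀ i ∈ Sᶜ, Integrable (fun ω => 16 * Y i ω + 18 * θ i ^ 2) P := fun i _ =>
    ((hYi i).const_mul _).add (integrable_const _)
  have hZ2 : ∀ i ∈ S, Integrable
      (fun ω => 2 * (1 + δ₂ n) * Y₂ ω + 2 * (X i ω - θ i) ^ 2) P := fun i _ =>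
    (hY₂i.const_mul _).add ((integrable_centered_sq hlaw i).const_mul 2)
  have hZi : Integrable Z P := (integrable_finsetSum _ hZ1).add (integrable_finsetSum _ hZ2)
  have hlossZ : ∀ᵐ ω ∂P, sqLoss (fun i => t (lam ω) (X i ω)) θ ≤ Z ω := by
    filter_upwards [hlevel] with ω hω
    have hl : 0 ≤ lam ω := (hlow ω).trans hω.1
    unfold sqLoss
    rw [← Finset.sum_compl_add_sum S]
    refine add_le_add (Finset.sum_le_sum fun i _ => ?_) (Finset.sum_le_sum fun i _ => ?_)
    · have h1 := ht.loss_le_of_small hκ₀.le hl (X i ω) (θ i)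
      have h2 := hY i ω (lam ω) hω.1
      linarith
    · have h1 := ht.loss_le_of_large hl (X i ω) (θ i)
      have h2 : lam ω ^ 2 ≤ (1 + δ₂ n) * Y₂ ω := by
        calc lam ω ^ 2 ≤ (√(1 + δ₂ n) * xiHat₂ α₂ fun i => X i ω) ^ 2 :=
              pow_le_pow_left₀ hl hω.2 2
          _ = (1 + δ₂ n) * (xiHat₂ α₂ fun i => X i ω) ^ 2 := by
              rw [mul_pow, Real.sq_sqrt (by linarith)]
          _ ≤ _ := mul_le_mul_of_nonneg_left (hY₂ ω) (by linarith)
      linarith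
  have hloss0 : ∀ ω, 0 ≤ sqLoss (fun i => t (lam ω) (X i ω)) θ := fun ω =>
    Finset.sum_nonneg fun _ _ => sq_nonneg _
  have hmeas : AEStronglyMeasurable (fun ω => sqLoss (fun i => t (lam ω) (X i ω)) θ) P := by
    have h1 : AEMeasurable (fun ω => sqLoss (fun i => t (max (lam ω) 0) (X i ω)) θ) P := by
      unfold sqLoss
      refine Finset.aemeasurable_fun_sum _ fun i _ => AEMeasurable.pow_const ?_ 2
      exact (ht.continuous_uncurry.measurable.comp_aemeasurable
        (hlam.prodMk (hlaw i).aemeasurable)).sub aemeasurable_const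
    refine h1.aestronglyMeasurable.congr ?_
    filter_upwards [hlevel] with ω hω
    rw [max_eq_left ((hlow ω).trans hω.1)]
  have hint : Integrable (fun ω => sqLoss (fun i => t (lam ω) (X i ω)) θ) P := by
    refine hZi.mono' hmeas ?_
    filter_upwards [hlossZ] with ω hω
    rwa [Real.norm_of_nonneg (hloss0 ω)]
  refine ⟨hint, ?_⟩
  have hM0 : 0 ≤ (16 * C * (32 * Real.exp 6) + 18 * E) * (1 + δ₂ n) := by positivity
  have key : ∀ l : ℝ≥0, ∫ ω, sqLoss (fun i => t (lam ω) (X i ω)) θ ∂P ≤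
      (16 * C * (32 * Real.exp 6) + 18 * E) * (1 + δ₂ n) *
        ∫ ω, sqLoss (fun i => soft l (X i ω)) θ ∂P := by
    intro l
    have hl : (0 : ℝ) ≤ l := l.coe_nonneg
    rw [integral_sqLoss_soft hlaw hl]
    have hR : 0 ≤ ∑ i, softRisk (θ i) l := Finset.sum_nonneg fun i _ => softRisk_nonneg _ _
    have hB : ∑ i, min (θ i ^ 2) 1 ≤ 32 * Real.exp 6 * ∑ i, softRisk (θ i) l := by
      rw [Finset.mul_sum]
      refine Finset.sum_le_sum fun i _ => le_trans ?_ (min_sq_add_one_le_softRisk hl (θ i))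
      exact min_le_min_left _ (by nlinarith [sq_nonneg (l : ℝ)])
    have hY0 : ∀ i, 0 ≤ ∫ ω, Y i ω ∂P := fun i => integral_nonneg fun ω =>
      (sq_nonneg _).trans (hY i ω _ le_rfl)
    have hY₂0 : 0 ≤ ∫ ω, Y₂ ω ∂P := integral_nonneg fun ω => (sq_nonneg _).trans (hY₂ ω)
    have hYS : ∑ i ∈ Sᶜ, ∫ ω, Y i ω ∂P ≤ ∑ i, ∫ ω, Y i ω ∂P :=
      Finset.sum_le_sum_of_subset_of_nonneg (Finset.subset_univ _) fun i _ _ => hY0 i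
    have hZE : ∫ ω, Z ω ∂P = 16 * ∑ i ∈ Sᶜ, ∫ ω, Y i ω ∂P + 18 * ∑ i ∈ Sᶜ, θ i ^ 2 +
        (2 * (1 + δ₂ n) * (S.card * ∫ ω, Y₂ ω ∂P) + 2 * S.card) := by
      simp only [Z]
      rw [integral_add (integrable_finsetSum _ hZ1) (integrable_finsetSum _ hZ2),
        integral_finsetSum _ hZ1, integral_finsetSum _ hZ2]
      congr 1
      · rw [Finset.mul_sum, Finset.mul_sum, ← Finset.sum_add_distrib]
        refine Finset.sum_congr rfl fun i _ => ?_
        rw [integral_add ((hYi i).const_mul _) (integrable_const _), integral_const_mul]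
        simp
      · have : ∀ i ∈ S, ∫ ω, (2 * (1 + δ₂ n) * Y₂ ω + 2 * (X i ω - θ i) ^ 2) ∂P =
            2 * (1 + δ₂ n) * ∫ ω, Y₂ ω ∂P + 2 := by
          intro i _
          rw [integral_add (hY₂i.const_mul _) ((integrable_centered_sq hlaw i).const_mul 2),
            integral_const_mul, integral_const_mul, integral_centered_sq hlaw i, mul_one]
        rw [Finset.sum_congr rfl this, Finset.sum_const, nsmul_eq_mul]
        ring
    have hSl := hSE l hl
    set T := ∑ i, softRisk (θ i) l with hT
    have hS0 : (0 : ℝ) ≤ S.card := Nat.cast_nonneg _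
    have hθ0 : 0 ≤ ∑ i ∈ Sᶜ, θ i ^ 2 := Finset.sum_nonneg fun _ _ => sq_nonneg _
    have hq0 : 0 ≤ (S.card : ℝ) * ∫ ω, Y₂ ω ∂P := mul_nonneg hS0 hY₂0
    calc ∫ ω, sqLoss (fun i => t (lam ω) (X i ω)) θ ∂P ≤ ∫ ω, Z ω ∂P :=
          integral_mono_ae hint hZi hlossZ
      _ ≤ 16 * (C * (32 * Real.exp 6 * T)) + 18 * (1 + δ₂ n) *
            (S.card * ∫ ω, Y₂ ω ∂P + S.card + ∑ i ∈ Sᶜ, θ i ^ 2) := by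
          rw [hZE]
          have h1 := mul_le_mul_of_nonneg_left hB hC
          have h2 := mul_nonneg hδ₂ hS0
          have h3 := mul_nonneg hδ₂ hθ0
          have h4 := mul_nonneg hδ₂ hq0
          linarith
      _ ≤ 16 * (C * (32 * Real.exp 6 * T)) * (1 + δ₂ n) + 18 * (1 + δ₂ n) * (E * T) := by
          refine add_le_add (le_mul_of_one_le_right (by positivity) (by linarith)) ?_
          exact mul_le_mul_of_nonneg_left hSl (by positivity)
      _ = _ := by ring
  rw [Real.mul_iInf_of_nonneg hM0]
  exact le_ciInf key
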